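/- Let $\mathcal{O}_2$ be the ring of germs at $0$ of holomorphic functions on $\mathbb{C}^2$, with maximal ideal $\mathfrak{m}$, and let $f\in\mathcal{O}_2$ be such that $C=\{f=0\}$ is a reduced curve at $0$, that is, $f(0)=0$ and $f$ is square-free (in particular $f\neq 0$). Let $\nu(f)$ be the algebraic multiplicity of $f$ (the order of its Taylor series at $0$), and for every integer $k\ge 0$ let \[\mu^{k}(C)=\dim_{\mathbb{C}}\frac{\mathcal{O}_2}{\langle f_x,f_y\rangle\,\mathfrak{m}^{k}}\] be the $k$-th Milnor number of $C$. For a direction $[\alpha:\beta]\in\mathbb{P}^1$, the polar curve of $df$ is $\mathcal{P}^{df}_{(\alpha:\beta)}=\{\alpha f_x+\beta f_y=0\}$, and \[i^{k}\bigl(\mathcal{P}^{df}_{(\alpha:\beta)},C\bigr)=\dim_{\mathbb{C}}\frac{\mathcal{O}_2}{\langle \alpha f_x+\beta f_y,\,f\rangle\,\mathfrak{m}^{k}}\] is its $k$-th polar intersection number with $C$. Then for a generic direction, that is, for all $[\alpha:\beta]$ in some nonempty Zariski-open subset $U$ of $\mathbb{P}^1$ (depending on $f$ but not on $k$), one has for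 all integers $k\ge 0$ that both dimensions are finite and \[i^{k}\bigl(\mathcal{P}^{df}_{(\alpha:\beta)},C\bigr)=\mu^{k}(C)+\nu(f)-1.\] -/

import Mathlib

open Filter Topology

noncomputable section

namespace PlaneGerm

/-- Germs at `0 ∈ ℂ²` of arbitrary complex functions form a `ℂ`-algebra (for Mathlib's ring and
module structures on germs). -/
instance germAlgebra : Algebra ℂ (Germ (𝓝 (0 : ℂ × ℂ)) ℂ) :=
  Algebra.ofModule
    (fun c φ ψ => Germ.inductionOn₂ φ ψ fun f g => by
      rw [← Germ.coe_smul, ← Germ.coe_mul, ← Germ.coe_mul, ← Germ.coe_smul, smul_mul_assoc])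
    (fun c φ ψ => Germ.inductionOn₂ φ ψ fun f g => by
      rw [← Germ.coe_smul, ← Germ.coe_mul, ← Germ.coe_mul, ← Germ.coe_smul, mul_smul_comm])

/-- `𝒪₂`: the ring of germs of holomorphic functions at `0 ∈ ℂ²`. -/
def O₂ : Subalgebra ℂ (Germ (𝓝 (0 : ℂ × ℂ)) ℂ) where
  carrier := {φ | ∃ f : ℂ × ℂ → ℂ, AnalyticAt ℂ f 0 ∧ (f : Germ (𝓝 (0 : ℂ × ℂ)) ℂ) = φ}
  mul_mem' := by
    rintro _ _ ⟨f, hf, rfl⟩ ⟨g, hg, rfl⟩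
    exact ⟨f * g, hf.mul hg, rfl⟩
  add_mem' := by
    rintro _ _ ⟨f, hf, rfl⟩ ⟨g, hg, rfl⟩
    exact ⟨f + g, hf.add hg, rfl⟩
  algebraMap_mem' := by
    intro c
    refine ⟨fun _ => c, analyticAt_const, ?_⟩
    rw [Algebra.algebraMap_eq_smul_one, ← Germ.coe_one, ← Germ.coe_smul]
    congr 1
    funext z
    simp

/-- The value at the origin, as a ring homomorphism `𝒪₂ → ℂ`. -/
def evalZero : O₂ →+* ℂ := Filter.Germ.valueRingHom.comp O₂.val.toRingHom

/-- The maximal ideal `𝔪 = {f ∈ 𝒪₂ | f(0) = 0}`. -/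
def 𝔪 : Ideal O₂ := RingHom.ker evalZero

/-- The germ of the directional derivative `z ↦ df(z)(v)`, on germs of arbitrary functions. -/
def germDeriv (v : ℂ × ℂ) (φ : Germ (𝓝 (0 : ℂ × ℂ)) ℂ) : Germ (𝓝 (0 : ℂ × ℂ)) ℂ :=
  Germ.map' (fun (f : ℂ × ℂ → ℂ) (z : ℂ × ℂ) => fderiv ℂ f z v)
    (fun _ _ h => h.fderiv.mono fun _ hz => congrArg (fun L : ℂ × ℂ →L[ℂ] ℂ => L v) hz) φ

theorem germDeriv_mem (v : ℂ × ℂ) {φ : Germ (𝓝 (0 : ℂ × ℂ)) ℂ} (h : φ ∈ O₂) :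
    germDeriv v φ ∈ O₂ := by
  obtain ⟨f, hf, rfl⟩ := h
  exact ⟨fun z => fderiv ℂ f z v,
    ((ContinuousLinearMap.apply ℂ ℂ v).analyticAt _).comp hf.fderiv, rfl⟩

/-- The partial derivative `f_x`. -/
def dx (f : O₂) : O₂ := ⟨germDeriv (1, 0) f, germDeriv_mem _ f.2⟩

/-- The partial derivative `f_y`. -/
def dy (f : O₂) : O₂ := ⟨germDeriv (0, 1) f, germDeriv_mem _ f.2⟩

/-- The algebraic multiplicity `ν(f)` of `f ≠ 0`: the smallest total degree `i + j` of a monomial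
`xⁱ yʲ` whose coefficient in the Taylor series of `f` at `0` is not zero. -/
def algMultiplicity (f : O₂) : ℕ :=
  sInf {n | ∃ i j : ℕ, i + j = n ∧ evalZero (dx^[i] (dy^[j] f)) ≠ 0}

/-- `{f = 0}` is a reduced curve germ at `0`: `f` vanishes at `0` and has no multiple factor
(in particular `f ≠ 0`). -/
def IsReducedCurve (f : O₂) : Prop := f ∈ 𝔪 ∧ Squarefree f

/-- The ideal `⟨f_x, f_y⟩ 𝔪ᵏ`. -/
def milnorIdeal (f : O₂) (k : ℕ) : Ideal O₂ := Ideal.span {dx f, dy f} * 𝔪 ^ k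

/-- The `k`-th Milnor number `μᵏ(C) = dim 𝒪₂ / ⟨f_x, f_y⟩ 𝔪ᵏ` of `C = {f = 0}`. -/
def milnorNumber (f : O₂) (k : ℕ) : ℕ := Module.finrank ℂ (O₂ ⧸ milnorIdeal f k)

/-- The equation `α f_x + β f_y` of the polar curve of `df` in the direction `[α : β]`. -/
def polar (f : O₂) (α β : ℂ) : O₂ := α • dx f + β • dy f

/-- The ideal `⟨α f_x + β f_y, f⟩ 𝔪ᵏ`. -/
def polarIdeal (f : O₂) (α β : ℂ) (k : ℕ) : Ideal O₂ := Ideal.span {polar f α β, f} * 𝔪 ^ k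

/-- The `k`-th polar intersection number `dim 𝒪₂ / ⟨α f_x + β f_y, f⟩ 𝔪ᵏ` in the direction
`[α : β]`. -/
def polarNumber (f : O₂) (α β : ℂ) (k : ℕ) : ℕ := Module.finrank ℂ (O₂ ⧸ polarIdeal f α β k)

/-- The projective line of directions `[α : β]`. -/
abbrev Directions : Type := Projectivization ℂ (Fin 2 → ℂ)

/-- Zariski-open sets of directions: the complements of the zero loci of sets of homogeneous
polynomials in two variables. -/
def IsZariskiOpen (U : Set Directions) : Prop :=
  ∃ S : Set (MvPolynomial (Fin 2) ℂ), (∀ p ∈ S, ∃ d : ℕ, p.IsHomogeneous d) ∧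
    ∀ (v : Fin 2 → ℂ) (hv : v ≠ 0),
      Projectivization.mk ℂ v hv ∈ U ↔ ∃ p ∈ S, MvPolynomial.eval v p ≠ 0

end PlaneGerm

end

/-! Take for `U` the directions in which the leading form of `f` does not vanish, that is, those not
tangent to `C`. A linear change of coordinates makes such a direction vertical. The polar curve
becomes `f_y = 0`, and with `n + 1 = ν(f)` the germ `f` has order `n + 1` on the `y`-axis while
`f_y` has order `n`, both there and at the origin.

For `k = 0` the claim is `i(f_y, f) = i(f_y, f_x) + n`. Let `t ↦ (x(t), y(t))` be an arc in a branch
`q` of `f_y = 0`. By the chain rule `t (f)' = f_x · t x'`, and `t d/dt` preserves the order of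
series without constant term, so `f` and `x f_x` have the same order along the arc
(`arc_associated`). Hence `i(q, f) = i(q, f_x) + i(q, x)`. Summing over the prime factors of `f_y`
gives `colength_polar`, where `i(f_y, x) = n`. Since `f` is square-free, it shares no branch with
`f_y` (`not_dvd_of_squarefree`). Equal orders along arcs become equal colengths through the
normalization of a branch, whose localizations are discrete valuation rings embedded in `ℂ⟦t⟧`
(`finrank_eq_of_arcs`).

For general `k`, a Koszul-type exact sequence shows that the colength of `(g, b) 𝔪ᵏ` exceeds that of
`(g, b)` by a number depending only on `k` and the order of `g`, provided `b` has at least this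
order (`colength_mul_pow`). Both ideals have `g = f_y`, so the correction cancels.

The commutative algebra of `O₂` rests on `weierstrass_division`: it makes `O₂ / (g)` finite over
`O₁` for `g` regular in `y`, which yields prime factors and principal height-one primes. -/

noncomputable section

/-! ### Germs in one and two variables: restriction, pullback, units and derivations. -/

namespace PlaneGerm

/-- Germs at `0 ∈ ℂ` of arbitrary complex functions form a `ℂ`-algebra. -/
instance germAlgebraLine : Algebra ℂ (Germ (𝓝 (0 : ℂ)) ℂ) :=
  Algebra.ofModule
    (fun c φ ψ => Germ.inductionOn₂ φ ψ fun f g => by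
      rw [← Germ.coe_smul, ← Germ.coe_mul, ← Germ.coe_mul, ← Germ.coe_smul, smul_mul_assoc])
    (fun c φ ψ => Germ.inductionOn₂ φ ψ fun f g => by
      rw [← Germ.coe_smul, ← Germ.coe_mul, ← Germ.coe_mul, ← Germ.coe_smul, mul_smul_comm])

/-- The ring of germs of holomorphic functions at `0 ∈ ℂ`. -/
def O₁ : Subalgebra ℂ (Germ (𝓝 (0 : ℂ)) ℂ) where
  carrier := {φ | ∃ f : ℂ → ℂ, AnalyticAt ℂ f 0 ∧ (f : Germ (𝓝 (0 : ℂ)) ℂ) = φ}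
  mul_mem' := by
    rintro _ _ ⟨f, hf, rfl⟩ ⟨g, hg, rfl⟩
    exact ⟨f * g, hf.mul hg, rfl⟩
  add_mem' := by
    rintro _ _ ⟨f, hf, rfl⟩ ⟨g, hg, rfl⟩
    exact ⟨f + g, hf.add hg, rfl⟩
  algebraMap_mem' := by
    intro c
    refine ⟨fun _ => c, analyticAt_const, ?_⟩
    rw [Algebra.algebraMap_eq_smul_one, ← Germ.coe_one, ← Germ.coe_smul]
    congr 1
    funext z
    simp

/-- The germ in `O₂` of a function analytic at the origin. -/
def germ₂ (f : ℂ × ℂ → ℂ) (hf : AnalyticAt ℂ f 0) : O₂ := ⟨f, f, hf, rfl⟩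

/-- The germ in `O₁` of a function analytic at the origin. -/
def germ₁ (f : ℂ → ℂ) (hf : AnalyticAt ℂ f 0) : O₁ := ⟨f, f, hf, rfl⟩

theorem exists_germ₂ (φ : O₂) : ∃ f hf, φ = germ₂ f hf := by
  obtain ⟨_, f, hf, rfl⟩ := φ
  exact ⟨f, hf, rfl⟩

theorem exists_germ₁ (φ : O₁) : ∃ f hf, φ = germ₁ f hf := by
  obtain ⟨_, f, hf, rfl⟩ := φ
  exact ⟨f, hf, rfl⟩

theorem germ₂_eq_iff {f g : ℂ × ℂ → ℂ} {hf hg} :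
    germ₂ f hf = germ₂ g hg ↔ f =ᶠ[𝓝 0] g := by
  rw [Subtype.ext_iff]; exact Germ.coe_eq

theorem germ₁_eq_iff {f g : ℂ → ℂ} {hf hg} :
    germ₁ f hf = germ₁ g hg ↔ f =ᶠ[𝓝 0] g := by
  rw [Subtype.ext_iff]; exact Germ.coe_eq

theorem germ₂_add {f g : ℂ × ℂ → ℂ} {hf hg} :
    germ₂ f hf + germ₂ g hg = germ₂ (f + g) (hf.add hg) := rfl

theorem germ₂_mul {f g : ℂ × ℂ → ℂ} {hf hg} :
    germ₂ f hf * germ₂ g hg = germ₂ (f * g) (hf.mul hg) := rfl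

theorem germ₁_mul {f g : ℂ → ℂ} {hf hg} :
    germ₁ f hf * germ₁ g hg = germ₁ (f * g) (hf.mul hg) := rfl

theorem germ₁_zero : (0 : O₁) = germ₁ 0 analyticAt_const := rfl

theorem germ₂_zero : (0 : O₂) = germ₂ 0 analyticAt_const := rfl

theorem germ₁_one : (1 : O₁) = germ₁ 1 analyticAt_const := rfl

theorem germ₂_one : (1 : O₂) = germ₂ 1 analyticAt_const := rfl

theorem algebraMap_germ₂ (c : ℂ) :
    algebraMap ℂ O₂ c = germ₂ (fun _ => c) analyticAt_const := by
  rw [Algebra.algebraMap_eq_smul_one]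
  apply Subtype.ext
  change c • (1 : Germ (𝓝 (0 : ℂ × ℂ)) ℂ) = _
  rw [← Germ.coe_one, ← Germ.coe_smul]
  change _ = ((fun _ => c : ℂ × ℂ → ℂ) : Germ (𝓝 (0 : ℂ × ℂ)) ℂ)
  congr 1
  funext z
  simp

theorem algebraMap_germ₁ (c : ℂ) :
    algebraMap ℂ O₁ c = germ₁ (fun _ => c) analyticAt_const := by
  rw [Algebra.algebraMap_eq_smul_one]
  apply Subtype.ext
  change c • (1 : Germ (𝓝 (0 : ℂ)) ℂ) = _
  rw [← Germ.coe_one, ← Germ.coe_smul]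
  change _ = ((fun _ => c : ℂ → ℂ) : Germ (𝓝 (0 : ℂ)) ℂ)
  congr 1
  funext z
  simp

@[simp] theorem evalZero_germ₂ (f : ℂ × ℂ → ℂ) (hf) : evalZero (germ₂ f hf) = f 0 := rfl

@[simp] theorem evalZero_algebraMap (c : ℂ) : evalZero (algebraMap ℂ O₂ c) = c := by
  rw [algebraMap_germ₂]; rfl

/-- The value at the origin of germs of one variable. -/
def evalZeroLine : O₁ →+* ℂ := Filter.Germ.valueRingHom.comp O₁.val.toRingHom

@[simp] theorem evalZeroLine_germ₁ (f : ℂ → ℂ) (hf) : evalZeroLine (germ₁ f hf) = f 0 := rfl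

@[simp] theorem evalZeroLine_algebraMap (c : ℂ) : evalZeroLine (algebraMap ℂ O₁ c) = c := by
  rw [algebraMap_germ₁]; rfl

/-! ### Pullbacks -/

/-- Pullback of germs along a linear endomorphism of the plane. -/
def pull (A : ℂ × ℂ →L[ℂ] ℂ × ℂ) : O₂ →ₐ[ℂ] O₂ where
  toFun φ := ⟨φ.1.compTendsto A (by simpa using A.continuous.tendsto 0), by
    obtain ⟨_, f, hf, rfl⟩ := φ
    exact ⟨f ∘ A, AnalyticAt.comp (by simpa using hf) (A.analyticAt 0), rfl⟩⟩
  map_one' := rfl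
  map_zero' := rfl
  map_mul' := by
    rintro ⟨_, f, hf, rfl⟩ ⟨_, g, hg, rfl⟩; rfl
  map_add' := by
    rintro ⟨_, f, hf, rfl⟩ ⟨_, g, hg, rfl⟩; rfl
  commutes' c := by
    rw [algebraMap_germ₂]; rfl

theorem analyticAt_comp_linear {f : ℂ × ℂ → ℂ} (hf : AnalyticAt ℂ f 0)
    (A : ℂ × ℂ →L[ℂ] ℂ × ℂ) : AnalyticAt ℂ (f ∘ A) 0 :=
  AnalyticAt.comp (by simpa using hf) (A.analyticAt 0)

theorem pull_germ₂ (A : ℂ × ℂ →L[ℂ] ℂ × ℂ) (f : ℂ × ℂ → ℂ) (hf) :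
    pull A (germ₂ f hf) = germ₂ (f ∘ A) (analyticAt_comp_linear hf A) := rfl

/-- Change of linear coordinates on germs. -/
def pullEquiv (A : (ℂ × ℂ) ≃L[ℂ] ℂ × ℂ) : O₂ ≃ₐ[ℂ] O₂ :=
  AlgEquiv.ofAlgHom (pull A) (pull A.symm)
    (by
      ext φ
      obtain ⟨f, hf, rfl⟩ := exists_germ₂ φ
      simp only [AlgHom.comp_apply, pull_germ₂, AlgHom.id_apply]
      congr 2
      funext z
      simp)
    (by
      ext φ
      obtain ⟨f, hf, rfl⟩ := exists_germ₂ φ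
      simp only [AlgHom.comp_apply, pull_germ₂, AlgHom.id_apply]
      congr 2
      funext z
      simp)

theorem pullEquiv_apply (A : (ℂ × ℂ) ≃L[ℂ] ℂ × ℂ) (φ : O₂) :
    pullEquiv A φ = pull A φ := rfl

/-- The parametrized line `t ↦ t • w`. -/
def line (w : ℂ × ℂ) : ℂ →L[ℂ] ℂ × ℂ := ContinuousLinearMap.toSpanSingleton ℂ w

@[simp] theorem line_apply (w : ℂ × ℂ) (t : ℂ) : line w t = t • w := rfl

/-- Restriction of germs to the line through the origin spanned by `w`. -/
def restr (w : ℂ × ℂ) : O₂ →ₐ[ℂ] O₁ where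
  toFun φ := ⟨φ.1.compTendsto (line w) (by simpa using (line w).continuous.tendsto 0), by
    obtain ⟨_, f, hf, rfl⟩ := φ
    exact ⟨f ∘ line w, AnalyticAt.comp (by simpa using hf) ((line w).analyticAt 0), rfl⟩⟩
  map_one' := rfl
  map_zero' := rfl
  map_mul' := by
    rintro ⟨_, f, hf, rfl⟩ ⟨_, g, hg, rfl⟩; rfl
  map_add' := by
    rintro ⟨_, f, hf, rfl⟩ ⟨_, g, hg, rfl⟩; rfl
  commutes' c := by
    rw [algebraMap_germ₂, algebraMap_germ₁]; rfl

theorem analyticAt_comp_line {f : ℂ × ℂ → ℂ} (hf : AnalyticAt ℂ f 0) (w : ℂ × ℂ) :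
    AnalyticAt ℂ (f ∘ line w) 0 :=
  AnalyticAt.comp (by simpa using hf) ((line w).analyticAt 0)

theorem restr_germ₂ (w : ℂ × ℂ) (f : ℂ × ℂ → ℂ) (hf) :
    restr w (germ₂ f hf) = germ₁ (f ∘ line w) (analyticAt_comp_line hf w) := rfl

/-- Pullback of one-variable germs along a linear functional of the plane. -/
def lift (A : ℂ × ℂ →L[ℂ] ℂ) : O₁ →ₐ[ℂ] O₂ where
  toFun φ := ⟨φ.1.compTendsto A (by simpa using A.continuous.tendsto 0), by
    obtain ⟨_, f, hf, rfl⟩ := φ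
    exact ⟨f ∘ A, AnalyticAt.comp (by simpa using hf) (A.analyticAt 0), rfl⟩⟩
  map_one' := rfl
  map_zero' := rfl
  map_mul' := by
    rintro ⟨_, f, hf, rfl⟩ ⟨_, g, hg, rfl⟩; rfl
  map_add' := by
    rintro ⟨_, f, hf, rfl⟩ ⟨_, g, hg, rfl⟩; rfl
  commutes' c := by
    rw [algebraMap_germ₂, algebraMap_germ₁]; rfl

theorem analyticAt_comp_functional {f : ℂ → ℂ} (hf : AnalyticAt ℂ f 0) (A : ℂ × ℂ →L[ℂ] ℂ) :
    AnalyticAt ℂ (f ∘ A) 0 :=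
  AnalyticAt.comp (by simpa using hf) (A.analyticAt 0)

theorem lift_germ₁ (A : ℂ × ℂ →L[ℂ] ℂ) (f : ℂ → ℂ) (hf) :
    lift A (germ₁ f hf) = germ₂ (f ∘ A) (analyticAt_comp_functional hf A) := rfl

/-- Germs of functions of the first variable, seen as germs on the plane. -/
def liftX : O₁ →ₐ[ℂ] O₂ := lift (ContinuousLinearMap.fst ℂ ℂ ℂ)

/-- Germs of functions of the second variable, seen as germs on the plane. -/
def liftY : O₁ →ₐ[ℂ] O₂ := lift (ContinuousLinearMap.snd ℂ ℂ ℂ)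

/-- The coordinate of the line. -/
def T : O₁ := germ₁ id analyticAt_id

/-- The first coordinate of the plane. -/
def X : O₂ := germ₂ Prod.fst analyticAt_fst

/-- The second coordinate of the plane. -/
def Y : O₂ := germ₂ Prod.snd analyticAt_snd

/-- Restriction to the `y`-axis. -/
abbrev restrY : O₂ →ₐ[ℂ] O₁ := restr (0, 1)

theorem restr_X (w : ℂ × ℂ) : restr w X = w.1 • T := by
  rw [Algebra.smul_def, algebraMap_germ₁, X, T, restr_germ₂, germ₁_mul]
  congr 1
  funext t
  simp [mul_comm]

theorem restr_Y (w : ℂ × ℂ) : restr w Y = w.2 • T := by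
  rw [Algebra.smul_def, algebraMap_germ₁, Y, T, restr_germ₂, germ₁_mul]
  congr 1
  funext t
  simp [mul_comm]

@[simp] theorem restrY_X : restrY X = 0 := by simp [restr_X]
@[simp] theorem restrY_Y : restrY Y = T := by simp [restr_Y]
theorem liftX_T : liftX T = X := rfl

theorem restr_liftX (a : O₁) : restr (1, 0) (liftX a) = a := by
  obtain ⟨f, hf, rfl⟩ := exists_germ₁ a
  rw [liftX, lift_germ₁, restr_germ₂]
  congr 1
  funext t
  simp

theorem restrY_liftY (a : O₁) : restrY (liftY a) = a := by
  obtain ⟨f, hf, rfl⟩ := exists_germ₁ a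
  rw [liftY, lift_germ₁, restr_germ₂]
  congr 1
  funext t
  simp

theorem restrY_surjective : Function.Surjective restrY := fun a => ⟨_, restrY_liftY a⟩

theorem evalZeroLine_restr (w : ℂ × ℂ) (φ : O₂) : evalZeroLine (restr w φ) = evalZero φ := by
  obtain ⟨f, hf, rfl⟩ := exists_germ₂ φ
  simp [restr_germ₂]

theorem evalZero_pull (A : ℂ × ℂ →L[ℂ] ℂ × ℂ) (φ : O₂) : evalZero (pull A φ) = evalZero φ := by
  obtain ⟨f, hf, rfl⟩ := exists_germ₂ φ
  simp [pull_germ₂]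

/-! ### Units and local structure -/

theorem isUnit_iff_evalZero (φ : O₂) : IsUnit φ ↔ evalZero φ ≠ 0 := by
  refine ⟨fun h => (h.map evalZero).ne_zero, fun h => ?_⟩
  obtain ⟨f, hf, rfl⟩ := exists_germ₂ φ
  refine IsUnit.of_mul_eq_one (germ₂ f⁻¹ (hf.inv h)) ?_
  rw [germ₂_mul, germ₂_one, germ₂_eq_iff]
  filter_upwards [hf.continuousAt.eventually_ne h] with z hz
  simp [hz]

theorem isUnit_iff_evalZeroLine (φ : O₁) : IsUnit φ ↔ evalZeroLine φ ≠ 0 := by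
  refine ⟨fun h => (h.map evalZeroLine).ne_zero, fun h => ?_⟩
  obtain ⟨f, hf, rfl⟩ := exists_germ₁ φ
  refine IsUnit.of_mul_eq_one (germ₁ f⁻¹ (hf.inv h)) ?_
  rw [germ₁_mul, germ₁_one, germ₁_eq_iff]
  filter_upwards [hf.continuousAt.eventually_ne h] with z hz
  simp [hz]

instance : Nontrivial O₂ := evalZero.domain_nontrivial
instance : Nontrivial O₁ := evalZeroLine.domain_nontrivial

instance : IsLocalRing O₂ := by
  refine .of_isUnit_or_isUnit_one_sub_self fun a => ?_
  simp only [isUnit_iff_evalZero, map_sub, map_one]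
  by_contra! h
  simp [h.1] at h

theorem maximalIdeal_eq : IsLocalRing.maximalIdeal O₂ = 𝔪 := by
  ext φ
  rw [IsLocalRing.mem_maximalIdeal, mem_nonunits_iff, isUnit_iff_evalZero, not_not]
  rfl

theorem mem_𝔪 {φ : O₂} : φ ∈ 𝔪 ↔ evalZero φ = 0 := Iff.rfl

theorem isUnit_iff_notMem {φ : O₂} : IsUnit φ ↔ φ ∉ 𝔪 := isUnit_iff_evalZero φ

instance 𝔪_isMaximal : (𝔪).IsMaximal := by
  rw [← maximalIdeal_eq]; infer_instance

theorem le_𝔪 {I : Ideal O₂} (h : I ≠ ⊤) : I ≤ 𝔪 := by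
  rw [← maximalIdeal_eq]; exact IsLocalRing.le_maximalIdeal h

theorem exists_eq_T_pow_mul (a : O₁) (ha : a ≠ 0) : ∃ (n : ℕ) (u : O₁), IsUnit u ∧ a = T ^ n * u := by
  obtain ⟨f, hf, rfl⟩ := exists_germ₁ a
  obtain ⟨n, g, hg, hg0, h⟩ := hf.exists_eventuallyEq_pow_smul_nonzero_iff.mpr
    (fun h0 => ha (by rw [germ₁_zero, germ₁_eq_iff]; exact h0))
  refine ⟨n, germ₁ g hg, (isUnit_iff_evalZeroLine _).2 hg0, ?_⟩
  have : ∀ n : ℕ, T ^ n = germ₁ (id ^ n) (analyticAt_id.pow n) := fun n => rfl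
  rw [this, germ₁_mul, germ₁_eq_iff]
  filter_upwards [h] with z hz
  simpa using hz

theorem T_pow_mul_ne_zero (n : ℕ) {u : O₁} (hu : IsUnit u) : T ^ n * u ≠ 0 := by
  obtain ⟨g, hg, rfl⟩ := exists_germ₁ u
  have : T ^ n = germ₁ (id ^ n) (analyticAt_id.pow n) := rfl
  rw [this, germ₁_mul, germ₁_zero, Ne, germ₁_eq_iff]
  intro h
  have h2 := hg.continuousAt.eventually_ne ((isUnit_iff_evalZeroLine _).1 hu)
  have h3 : ∀ᶠ z : ℂ in 𝓝[≠] 0, False := by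
    filter_upwards [h.filter_mono nhdsWithin_le_nhds, h2.filter_mono nhdsWithin_le_nhds,
      self_mem_nhdsWithin] with z h h2 h3
    simp_all
  exact (inferInstance : (𝓝[≠] (0 : ℂ)).NeBot).ne (by simpa using h3)

instance : IsDomain O₁ := by
  refine @NoZeroDivisors.to_isDomain _ _ _ ⟨fun {a b} h => ?_⟩
  by_contra! hab
  obtain ⟨n, u, hu, rfl⟩ := exists_eq_T_pow_mul a hab.1
  obtain ⟨k, v, hv, rfl⟩ := exists_eq_T_pow_mul b hab.2
  refine T_pow_mul_ne_zero (n + k) (hu.mul hv) ?_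
  rw [← h]; ring

theorem not_isUnit_T : ¬ IsUnit T := by
  rw [isUnit_iff_evalZeroLine]; simp [T]

theorem T_ne_zero : T ≠ 0 := by
  simpa using T_pow_mul_ne_zero 1 isUnit_one

theorem T_dvd_iff (a : O₁) : T ∣ a ↔ evalZeroLine a = 0 := by
  constructor
  · rintro ⟨b, rfl⟩; simp [T]
  · intro h
    by_cases ha : a = 0
    · simp [ha]
    obtain ⟨n, u, hu, rfl⟩ := exists_eq_T_pow_mul a ha
    rcases n with _ | n
    · exact absurd h (by simpa using (isUnit_iff_evalZeroLine u).1 hu)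
    · exact ⟨T ^ n * u, by ring⟩

theorem irreducible_T : Irreducible T := by
  refine ⟨not_isUnit_T, fun {a b} h => ?_⟩
  by_contra! hab
  simp only [isUnit_iff_evalZeroLine, not_not] at hab
  obtain ⟨c, rfl⟩ := (T_dvd_iff a).2 hab.1
  obtain ⟨d, rfl⟩ := (T_dvd_iff b).2 hab.2
  refine not_isUnit_T (IsUnit.of_mul_eq_one (c * d) ?_)
  refine mul_left_cancel₀ T_ne_zero ?_
  linear_combination -h

instance : IsDiscreteValuationRing O₁ :=
  IsDiscreteValuationRing.ofHasUnitMulPowIrreducibleFactorization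
    ⟨T, irreducible_T, fun {a} ha => by
      obtain ⟨n, u, hu, rfl⟩ := exists_eq_T_pow_mul a ha
      exact ⟨n, hu.unit, rfl⟩⟩

/-! ### Derivations -/

/-- The germ of the directional derivative along `v`. -/
def dv (v : ℂ × ℂ) (φ : O₂) : O₂ := ⟨germDeriv v φ, germDeriv_mem v φ.2⟩

theorem dx_eq_dv (φ : O₂) : dx φ = dv (1, 0) φ := rfl
theorem dy_eq_dv (φ : O₂) : dy φ = dv (0, 1) φ := rfl

theorem analyticAt_fderiv_apply {f : ℂ × ℂ → ℂ} (hf : AnalyticAt ℂ f 0) (v : ℂ × ℂ) :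
    AnalyticAt ℂ (fun z => fderiv ℂ f z v) 0 :=
  ((ContinuousLinearMap.apply ℂ ℂ v).analyticAt _).comp hf.fderiv

theorem dv_germ₂ (v : ℂ × ℂ) (f : ℂ × ℂ → ℂ) (hf) :
    dv v (germ₂ f hf) = germ₂ (fun z => fderiv ℂ f z v) (analyticAt_fderiv_apply hf v) := rfl

theorem dv_add (v : ℂ × ℂ) (φ ψ : O₂) : dv v (φ + ψ) = dv v φ + dv v ψ := by
  obtain ⟨f, hf, rfl⟩ := exists_germ₂ φ
  obtain ⟨g, hg, rfl⟩ := exists_germ₂ ψ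
  rw [germ₂_add, dv_germ₂, dv_germ₂, dv_germ₂, germ₂_add, germ₂_eq_iff]
  filter_upwards [hf.eventually_analyticAt, hg.eventually_analyticAt] with z h1 h2
  simp [fderiv_add h1.differentiableAt h2.differentiableAt]

theorem dv_mul (v : ℂ × ℂ) (φ ψ : O₂) : dv v (φ * ψ) = φ * dv v ψ + ψ * dv v φ := by
  obtain ⟨f, hf, rfl⟩ := exists_germ₂ φ
  obtain ⟨g, hg, rfl⟩ := exists_germ₂ ψ
  simp only [germ₂_mul, dv_germ₂, germ₂_add]
  rw [germ₂_eq_iff]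
  filter_upwards [hf.eventually_analyticAt, hg.eventually_analyticAt] with z h1 h2
  simp [fderiv_mul h1.differentiableAt h2.differentiableAt]

theorem dv_algebraMap (v : ℂ × ℂ) (c : ℂ) : dv v (algebraMap ℂ O₂ c) = 0 := by
  rw [algebraMap_germ₂, dv_germ₂, germ₂_zero, germ₂_eq_iff]
  filter_upwards with z
  simp

/-- The directional derivative as a derivation of `O₂`. -/
def dvDer (v : ℂ × ℂ) : Derivation ℂ O₂ O₂ :=
  Derivation.mk'
    { toFun := dv v
      map_add' := dv_add v
      map_smul' := fun c φ => by
        rw [Algebra.smul_def, dv_mul, dv_algebraMap, mul_zero, add_zero, Algebra.smul_def]; rfl }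
    (fun a b => by simpa using dv_mul v a b)

theorem dvDer_apply (v : ℂ × ℂ) (φ : O₂) : dvDer v φ = dv v φ := rfl

theorem dv_X (v : ℂ × ℂ) : dv v X = algebraMap ℂ O₂ v.1 := by
  rw [X, dv_germ₂, algebraMap_germ₂, germ₂_eq_iff]
  filter_upwards with z
  simp [fderiv_fst]

theorem dv_Y (v : ℂ × ℂ) : dv v Y = algebraMap ℂ O₂ v.2 := by
  rw [Y, dv_germ₂, algebraMap_germ₂, germ₂_eq_iff]
  filter_upwards with z
  simp [fderiv_snd]

theorem dv_eq (v : ℂ × ℂ) (φ : O₂) : dv v φ = v.1 • dx φ + v.2 • dy φ := by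
  obtain ⟨f, hf, rfl⟩ := exists_germ₂ φ
  simp only [dx_eq_dv, dy_eq_dv, dv_germ₂, Algebra.smul_def, algebraMap_germ₂, germ₂_add, germ₂_mul]
  rw [germ₂_eq_iff]
  filter_upwards with z
  have : v = v.1 • ((1, 0) : ℂ × ℂ) + v.2 • ((0, 1) : ℂ × ℂ) := by ext <;> simp
  conv_lhs => rw [this, map_add, map_smul, map_smul]
  simp

theorem dv_pull (A : ℂ × ℂ →L[ℂ] ℂ × ℂ) (v : ℂ × ℂ) (φ : O₂) :
    dv v (pull A φ) = pull A (dv (A v) φ) := by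
  obtain ⟨f, hf, rfl⟩ := exists_germ₂ φ
  rw [dv_germ₂, pull_germ₂, pull_germ₂, dv_germ₂, germ₂_eq_iff]
  have h : Tendsto A (𝓝 0) (𝓝 0) := by simpa using A.continuous.tendsto 0
  filter_upwards [h.eventually hf.eventually_analyticAt] with z hz
  rw [fderiv_comp z hz.differentiableAt A.differentiableAt]
  simp

end PlaneGerm

end

/-! ### Weierstrass division by perturbing an isomorphism of Banach spaces. -/

noncomputable section

namespace PlaneGerm

open Metric

/-! ### The disc algebra -/

open Classical in
/-- A continuous function on a closed disc, extended by zero. -/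
def discExt {s : ℝ} (g : C(closedBall (0 : ℂ) s, ℂ)) (z : ℂ) : ℂ :=
  if h : z ∈ closedBall (0 : ℂ) s then g ⟨z, h⟩ else 0

theorem discExt_of_mem {s : ℝ} (g : C(closedBall (0 : ℂ) s, ℂ)) {z : ℂ}
    (h : z ∈ closedBall (0 : ℂ) s) : discExt g z = g ⟨z, h⟩ := dif_pos h

theorem continuousOn_discExt {s : ℝ} (g : C(closedBall (0 : ℂ) s, ℂ)) :
    ContinuousOn (discExt g) (closedBall 0 s) := by
  rw [continuousOn_iff_continuous_domRestrict]
  convert g.continuous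
  exact funext fun z => discExt_of_mem g z.2

/-- The algebra of continuous functions on the closed disc of radius `s` that are holomorphic in
the interior. -/
def DiscAlg (s : ℝ) : Subalgebra ℂ C(closedBall (0 : ℂ) s, ℂ) where
  carrier := {g | DifferentiableOn ℂ (discExt g) (ball 0 s)}
  mul_mem' {f g} hf hg := (DifferentiableOn.mul hf hg).congr fun z hz => by
    simp [discExt_of_mem _ (ball_subset_closedBall hz)]
  add_mem' {f g} hf hg := (DifferentiableOn.add hf hg).congr fun z hz => by
    simp [discExt_of_mem _ (ball_subset_closedBall hz)]
  algebraMap_mem' c := (differentiableOn_const c).congr fun z hz => by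
    simp [discExt_of_mem _ (ball_subset_closedBall hz)]

/-- Uniform limits of holomorphic functions are holomorphic. This makes the disc algebra a Banach
algebra, so that the open mapping theorem and inversion of operators apply. -/
theorem isClosed_discAlg (s : ℝ) : IsClosed (DiscAlg s : Set C(closedBall (0 : ℂ) s, ℂ)) := by
  refine IsSeqClosed.isClosed fun g g₀ hg h => ?_
  refine TendstoLocallyUniformlyOn.differentiableOn (φ := atTop) (F := fun n => discExt (g n))
    (TendstoUniformlyOn.tendstoLocallyUniformlyOn ?_) (Eventually.of_forall hg) isOpen_ball
  rw [ContinuousMap.tendsto_iff_tendstoUniformly] at h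
  rw [Metric.tendstoUniformlyOn_iff]
  rw [Metric.tendstoUniformly_iff] at h
  intro ε hε
  filter_upwards [h ε hε] with n hn z hz
  rw [discExt_of_mem _ (ball_subset_closedBall hz), discExt_of_mem _ (ball_subset_closedBall hz)]
  exact hn _

instance (s : ℝ) : CompleteSpace (DiscAlg s) := (isClosed_discAlg s).completeSpace_coe

/-- The element of the disc algebra given by a function on the plane. -/
def discOf {s : ℝ} (G : ℂ → ℂ) (hc : ContinuousOn G (closedBall 0 s))
    (hd : DifferentiableOn ℂ G (ball 0 s)) : DiscAlg s :=
  ⟨⟨fun z => G z, continuousOn_iff_continuous_domRestrict.1 hc⟩, hd.congr fun z hz => by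
    rw [discExt_of_mem _ (ball_subset_closedBall hz)]; rfl⟩

/-- Evaluation at a point of the closed disc. -/
def discEval {s : ℝ} (z : closedBall (0 : ℂ) s) : DiscAlg s →L[ℂ] ℂ :=
  (ContinuousMap.evalCLM ℂ z).comp (DiscAlg s).toSubmodule.subtypeL

@[simp] theorem discEval_add {s : ℝ} (z : closedBall (0 : ℂ) s) (f g : DiscAlg s) :
    discEval z (f + g) = discEval z f + discEval z g := rfl

@[simp] theorem discEval_mul {s : ℝ} (z : closedBall (0 : ℂ) s) (f g : DiscAlg s) :
    discEval z (f * g) = discEval z f * discEval z g := rfl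

@[simp] theorem discEval_pow {s : ℝ} (z : closedBall (0 : ℂ) s) (f : DiscAlg s) (n : ℕ) :
    discEval z (f ^ n) = discEval z f ^ n := rfl

@[simp] theorem discEval_one {s : ℝ} (z : closedBall (0 : ℂ) s) :
    discEval z (1 : DiscAlg s) = 1 := rfl

@[simp] theorem discEval_discOf {s : ℝ} (z : closedBall (0 : ℂ) s) (G : ℂ → ℂ) (hc) (hd) :
    discEval z (discOf G hc hd) = G z := rfl

theorem disc_ext {s : ℝ} {f g : DiscAlg s} (h : ∀ z, discEval z f = discEval z g) : f = g :=
  Subtype.ext (ContinuousMap.ext h)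

/-- The coordinate function on the disc. -/
def discY (s : ℝ) : DiscAlg s := discOf id continuousOn_id differentiableOn_id

@[simp] theorem discEval_discY {s : ℝ} (z : closedBall (0 : ℂ) s) : discEval z (discY s) = z := rfl

/-- The centre of the disc. -/
def centre {s : ℝ} (hs : 0 < s) : closedBall (0 : ℂ) s := ⟨0, by simp [hs.le]⟩

@[simp] theorem coe_centre {s : ℝ} (hs : 0 < s) : (centre hs : ℂ) = 0 := rfl

/-- The quotient is the slope function at the centre, which is holomorphic there by removability of
the singularity. -/
theorem exists_eq_discY_mul_add {s : ℝ} (hs : 0 < s) (g : DiscAlg s) :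
    ∃ q : DiscAlg s, g = q * discY s + discEval (centre hs) g • 1 := by
  have hdiff : DifferentiableOn ℂ (discExt g.1) (ball 0 s) := g.2
  refine ⟨discOf (dslope (discExt g.1) 0) ?_ ?_, ?_⟩
  · exact (continuousOn_dslope (closedBall_mem_nhds _ hs)).2 ⟨continuousOn_discExt _,
      hdiff.differentiableAt (ball_mem_nhds _ hs)⟩
  · exact (Complex.differentiableOn_dslope (ball_mem_nhds _ hs)).2 hdiff
  · refine disc_ext fun z => ?_
    have h := sub_smul_dslope (discExt g.1) 0 z
    have h1 : discExt g.1 z = discEval z g := discExt_of_mem _ z.2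
    have h2 : discExt g.1 0 = discEval (centre hs) g := discExt_of_mem _ (centre hs).2
    rw [h1, h2] at h
    simp only [discEval_add, discEval_mul, map_smul, discEval_one, discEval_discOf, discEval_discY]
    simp only [sub_zero, smul_eq_mul] at h ⊢
    linear_combination -h

theorem mul_discY_eq_zero {s : ℝ} (hs : 0 < s) {g : DiscAlg s} (h : g * discY s = 0) : g = 0 := by
  have h1 : ∀ z : closedBall (0 : ℂ) s, (z : ℂ) ≠ 0 → discEval z g = 0 := fun z hz => by
    have := congrArg (discEval z) h
    simpa [hz] using this
  have hc : ContinuousAt (discExt g.1) 0 :=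
    (continuousOn_discExt g.1).continuousAt (closedBall_mem_nhds _ hs)
  have h0 : discExt g.1 0 = 0 := by
    refine tendsto_nhds_unique (hc.tendsto.mono_left (nhdsWithin_le_nhds (s := {0}ᶜ)))
      (tendsto_const_nhds.congr' ?_)
    filter_upwards [self_mem_nhdsWithin, mem_nhdsWithin_of_mem_nhds (closedBall_mem_nhds _ hs)]
      with z hz hz2
    rw [discExt_of_mem _ hz2]
    exact (h1 ⟨z, hz2⟩ hz).symm
  refine disc_ext fun z => ?_
  by_cases hz : (z : ℂ) = 0
  · have h2 : discExt g.1 0 = discEval (centre hs) g := discExt_of_mem _ (centre hs).2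
    have : z = centre hs := Subtype.ext hz
    rw [this, ← h2, h0, map_zero]
  · rw [h1 z hz, map_zero]

/-- The polynomial function on the disc with given coefficients. -/
def discPoly (s : ℝ) (d : ℕ) : (Fin d → ℂ) →L[ℂ] DiscAlg s :=
  LinearMap.toContinuousLinearMap (∑ j : Fin d, (LinearMap.proj j).smulRight (discY s ^ (j : ℕ)))

theorem discPoly_apply (s : ℝ) (d : ℕ) (c : Fin d → ℂ) :
    discPoly s d c = ∑ j : Fin d, c j • discY s ^ (j : ℕ) := by
  simp [discPoly]

/-- The map `(q, c) ↦ q a + ∑ cⱼ yʲ`, whose inverse is division by `a`. -/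
def divMap (s : ℝ) (d : ℕ) (a : DiscAlg s) : DiscAlg s × (Fin d → ℂ) →L[ℂ] DiscAlg s :=
  (ContinuousLinearMap.mul ℂ (DiscAlg s) a).comp (ContinuousLinearMap.fst ℂ _ _) +
    (discPoly s d).comp (ContinuousLinearMap.snd ℂ _ _)

theorem divMap_apply (s : ℝ) (d : ℕ) (a q : DiscAlg s) (c : Fin d → ℂ) :
    divMap s d a (q, c) = q * a + ∑ j : Fin d, c j • discY s ^ (j : ℕ) := by
  simp [divMap, discPoly_apply, mul_comm]

/-- Splitting off the value at the centre `d` times expands `g` up to order `d`; the unit is then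
absorbed into the quotient. -/
theorem divMap_surjective {s : ℝ} (hs : 0 < s) (d : ℕ) {u : DiscAlg s} (hu : IsUnit u) :
    Function.Surjective (divMap s d (discY s ^ d * u)) := by
  intro g
  have key : ∃ (q : DiscAlg s) (c : Fin d → ℂ),
      g = q * discY s ^ d + ∑ j : Fin d, c j • discY s ^ (j : ℕ) := by
    induction d with
    | zero => exact ⟨g, 0, by simp⟩
    | succ d ih =>
      obtain ⟨q, c, h⟩ := ih
      obtain ⟨q', hq'⟩ := exists_eq_discY_mul_add hs q
      refine ⟨q', Fin.snoc c (discEval (centre hs) q), ?_⟩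
      rw [Fin.sum_univ_castSucc]
      simp only [Fin.snoc_castSucc, Fin.snoc_last, Fin.val_castSucc, Fin.val_last]
      rw [h]
      nth_rw 1 [hq']
      rw [add_mul, smul_mul_assoc, one_mul]
      ring
  obtain ⟨q, c, h⟩ := key
  obtain ⟨v, hv⟩ := hu.exists_left_inv
  refine ⟨(q * v, c), ?_⟩
  rw [divMap_apply, h]
  linear_combination (q * discY s ^ d) * hv

/-- Evaluation at the centre kills the lowest coefficient, after which one factor `y` cancels. -/
theorem divMap_injective {s : ℝ} (hs : 0 < s) (d : ℕ) {u : DiscAlg s} (hu : IsUnit u) :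
    Function.Injective (divMap s d (discY s ^ d * u)) := by
  rw [injective_iff_map_eq_zero]
  rintro ⟨q, c⟩ h
  rw [divMap_apply] at h
  induction d with
  | zero =>
    have : q = 0 := by simpa [hu.mul_left_eq_zero] using h
    exact Prod.ext this (Subsingleton.elim _ _)
  | succ d ih =>
    rw [Fin.sum_univ_succ] at h
    have h0 : c 0 = 0 := by
      have := congrArg (discEval (centre hs)) h
      simpa using this
    have h1 : (q * (discY s ^ d * u) + ∑ j : Fin d, c j.succ • discY s ^ (j : ℕ)) * discY s = 0 := by
      rw [← h, h0, add_mul, Finset.sum_mul]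
      simp only [zero_smul, zero_add, Fin.val_succ, pow_succ, smul_mul_assoc]
      congr 1
      ring
    have h2 := ih (fun j => c j.succ) (mul_discY_eq_zero hs h1)
    rw [Prod.mk_eq_zero] at h2 ⊢
    refine ⟨h2.1, funext fun j => ?_⟩
    refine Fin.cases h0 (fun j => congrFun h2.2 j) j

/-- Division by `yᵈ u`, `u` a unit, as an isomorphism of Banach spaces. -/
def divEquiv {s : ℝ} (hs : 0 < s) (d : ℕ) {u : DiscAlg s} (hu : IsUnit u) :
    (DiscAlg s × (Fin d → ℂ)) ≃L[ℂ] DiscAlg s :=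
  -- Continuity of the inverse is the open mapping theorem.
  ContinuousLinearEquiv.ofBijective (divMap s d (discY s ^ d * u))
    (LinearMap.ker_eq_bot.2 (divMap_injective hs d hu))
    (LinearMap.range_eq_top.2 (divMap_surjective hs d hu))

theorem divEquiv_apply {s : ℝ} (hs : 0 < s) (d : ℕ) {u : DiscAlg s} (hu : IsUnit u)
    (p : DiscAlg s × (Fin d → ℂ)) : divEquiv hs d hu p = divMap s d (discY s ^ d * u) p := rfl

/-! ### Holomorphic families in the disc algebra -/

/-- A continuous family of elements of a Banach space that is holomorphic when tested on a
separating set of functionals is holomorphic. -/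
theorem analyticAt_of_separating {E ι : Type*} [NormedAddCommGroup E] [NormedSpace ℂ E]
    [CompleteSpace E] (ev : ι → E →L[ℂ] ℂ) (hev : ∀ f g, (∀ i, ev i f = ev i g) → f = g)
    {F : ℂ → E} {r : ℝ} (hr : 0 < r) (hc : ContinuousOn F (closedBall 0 r))
    (hd : ∀ i, DifferentiableOn ℂ (fun x => ev i (F x)) (ball 0 r)) : AnalyticAt ℂ F 0 := by
  lift r to NNReal using hr.le
  have hci : CircleIntegrable F 0 r :=
    (hc.mono sphere_subset_closedBall).circleIntegrable r.2
  -- The Cauchy integral of `F` is analytic for any continuous `F`; each functional commutes with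
  -- it, and the scalar Cauchy formula identifies it with `F`.
  have h := (hasFPowerSeriesOn_cauchy_integral hci (by exact_mod_cast hr)).analyticAt
  refine h.congr ?_
  filter_upwards [ball_mem_nhds (0 : ℂ) hr] with w hw
  refine hev _ _ fun i => ?_
  have hsm : CircleIntegrable (fun z => (z - w)⁻¹ • F z) 0 r := by
    refine ContinuousOn.circleIntegrable r.2 ?_
    refine ContinuousOn.smul (ContinuousOn.inv₀ (by fun_prop) fun z hz => ?_)
      (hc.mono sphere_subset_closedBall)
    rw [sub_ne_zero]
    rintro rfl
    simp only [mem_sphere_iff_norm, mem_ball_iff_norm] at hz hw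
    linarith
  have hcomm : ev i (∮ z in C(0, r), (z - w)⁻¹ • F z) = ∮ z in C(0, r), (z - w)⁻¹ • ev i (F z) := by
    simp only [circleIntegral]
    rw [← ContinuousLinearMap.intervalIntegral_comp_comm _ hsm.out]
    simp
  rw [map_smul, hcomm]
  have hdc : DiffContOnCl ℂ (fun x => ev i (F x)) (ball 0 r) :=
    ⟨hd i, by rw [closure_ball _ hr.ne']; exact (ev i).continuous.comp_continuousOn hc⟩
  exact hdc.two_pi_i_inv_smul_circleIntegral_sub_inv_smul hw

/-- The resolvent of an operator, applied to a holomorphic family. -/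
theorem analyticAt_resolvent_apply {E : Type*} [NormedAddCommGroup E] [NormedSpace ℂ E]
    [CompleteSpace E] (S : E →L[ℂ] E) {F : ℂ → E} (hF : AnalyticAt ℂ F 0) :
    AnalyticAt ℂ (fun p : ℂ × ℂ => Ring.inverse (1 - p.2 • S) (F p.1)) 0 := by
  have hR : AnalyticAt ℂ (fun y : ℂ => Ring.inverse (1 - y • S)) 0 := by
    refine AnalyticAt.fun_comp (g := fun A : E →L[ℂ] E => Ring.inverse (1 - A))
      (f := fun y : ℂ => y • S) ?_ (analyticAt_id.smul analyticAt_const)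
    rw [zero_smul]
    exact analyticAt_inverse_one_sub ℂ _
  have h1 : AnalyticAt ℂ (fun p : ℂ × ℂ => Ring.inverse (1 - p.2 • S)) 0 :=
    AnalyticAt.fun_comp (g := fun y : ℂ => Ring.inverse (1 - y • S)) (f := Prod.snd)
      (by simpa using hR) analyticAt_snd
  have h2 : AnalyticAt ℂ (fun p : ℂ × ℂ => F p.1) 0 :=
    AnalyticAt.fun_comp (f := Prod.fst) (by simpa using hF) analyticAt_fst
  exact AnalyticAt.comp₂ (h := fun q : (E →L[ℂ] E) × E => q.1 q.2)
    ((ContinuousLinearMap.id ℂ (E →L[ℂ] E)).analyticAt_bilinear _) h1 h2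

theorem resolvent_apply {E : Type*} [NormedAddCommGroup E] [NormedSpace ℂ E]
    [CompleteSpace E] (S : E →L[ℂ] E) {y : ℂ} (hy : ‖y‖ < (‖S‖ + 1)⁻¹) (a : E) :
    Ring.inverse (1 - y • S) a = a + y • S (Ring.inverse (1 - y • S) a) := by
  have hunit : IsUnit (1 - y • S) := by
    refine isUnit_one_sub_of_norm_lt_one ?_
    rw [norm_smul]
    calc ‖y‖ * ‖S‖ ≤ ‖y‖ * (‖S‖ + 1) := by gcongr; linarith
      _ < (‖S‖ + 1)⁻¹ * (‖S‖ + 1) := by gcongr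
      _ = 1 := inv_mul_cancel₀ (by positivity)
  have h1 := congrArg (fun A : E →L[ℂ] E => A a) (Ring.mul_inverse_cancel _ hunit)
  simp only [mul_apply_eq_comp, sub_apply, one_apply_eq_self, smul_apply] at h1
  exact sub_eq_iff_eq_add.1 h1

/-- A holomorphic family of linear equations of the form `F q + L c = G` that is uniquely solvable
at the origin has a holomorphic solution. -/
theorem exists_analyticAt_solution {E C : Type*} [NormedCommRing E] [NormedAlgebra ℂ E]
    [CompleteSpace E] [NormedAddCommGroup C] [NormedSpace ℂ C] (L : C →L[ℂ] E)
    {F G : ℂ → E} (hF : AnalyticAt ℂ F 0) (hG : AnalyticAt ℂ G 0) (Φ : (E × C) ≃L[ℂ] E)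
    (hΦ : ∀ p, Φ p = F 0 * p.1 + L p.2) :
    ∃ (q : ℂ → E) (c : ℂ → C), AnalyticAt ℂ q 0 ∧ AnalyticAt ℂ c 0 ∧
      ∀ᶠ x in 𝓝 0, F x * q x + L (c x) = G x := by
  let M : ℂ → E × C →L[ℂ] E := fun x =>
    (ContinuousLinearMap.mul ℂ E (F x)).comp (ContinuousLinearMap.fst ℂ E C) +
      L.comp (ContinuousLinearMap.snd ℂ E C)
  -- `D x` is the operator of the equation at `x`, read through the isomorphism at `0`. It is the
  -- identity at `x = 0`, hence invertible nearby with holomorphic inverse.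
  let D : ℂ → E →L[ℂ] E := fun x => (M x).comp Φ.symm.toContinuousLinearMap
  have hD0 : D 0 = 1 := by
    ext1 a
    refine Eq.trans ?_ (Φ.apply_symm_apply a)
    rw [hΦ]
    rfl
  have hD : AnalyticAt ℂ D 0 := by
    have h1 : AnalyticAt ℂ (fun x => ContinuousLinearMap.mul ℂ E (F x)) 0 :=
      ((ContinuousLinearMap.mul ℂ E).analyticAt _).fun_comp hF
    have h2 : AnalyticAt ℂ (fun x => (ContinuousLinearMap.mul ℂ E (F x)).comp
        (ContinuousLinearMap.fst ℂ E C)) 0 :=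
      (((ContinuousLinearMap.compL ℂ (E × C) E E).flip
        (ContinuousLinearMap.fst ℂ E C)).analyticAt _).fun_comp h1
    have h3 : AnalyticAt ℂ M 0 := h2.add analyticAt_const
    exact (((ContinuousLinearMap.compL ℂ E (E × C) E).flip
        Φ.symm.toContinuousLinearMap).analyticAt _).fun_comp h3
  have hDinv : AnalyticAt ℂ (fun x => Ring.inverse (D x)) 0 := by
    refine AnalyticAt.fun_comp (f := D) ?_ hD
    rw [hD0]
    exact analyticAt_inverse (1 : (E →L[ℂ] E)ˣ)
  have hDunit : ∀ᶠ x in 𝓝 0, IsUnit (D x) :=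
    hD.continuousAt.eventually (Units.isOpen.mem_nhds (by rw [hD0]; exact isUnit_one))
  let P : ℂ → E × C := fun x => Φ.symm (Ring.inverse (D x) (G x))
  have hP : AnalyticAt ℂ P 0 := by
    refine AnalyticAt.fun_comp (g := Φ.symm) (Φ.symm.toContinuousLinearMap.analyticAt _) ?_
    exact AnalyticAt.comp₂ (h := fun q : (E →L[ℂ] E) × E => q.1 q.2)
        ((ContinuousLinearMap.id ℂ (E →L[ℂ] E)).analyticAt_bilinear _) hDinv hG
  refine ⟨fun x => (P x).1, fun x => (P x).2, analyticAt_fst.fun_comp hP,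
    analyticAt_snd.fun_comp hP, ?_⟩
  filter_upwards [hDunit] with x hx
  exact congrArg (fun A : E →L[ℂ] E => A (G x)) (Ring.mul_inverse_cancel _ hx)

/-- Below `ε` the product of two closed discs of radius `s` lies in the domain of analyticity. The
family `x ↦ f (x, ·)` is continuous by currying and holomorphic after every evaluation, so
`analyticAt_of_separating` applies. -/
theorem exists_disc_family {f : ℂ × ℂ → ℂ} (hf : AnalyticAt ℂ f 0) :
    ∃ ε > 0, ∀ s : ℝ, 0 < s → s < ε → ∃ F : ℂ → DiscAlg s, AnalyticAt ℂ F 0 ∧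
      ∀ᶠ x in 𝓝 0, ∀ y : closedBall (0 : ℂ) s, discEval y (F x) = f (x, y) := by
  obtain ⟨ε, hε, h⟩ := Metric.eventually_nhds_iff_ball.1 hf.eventually_analyticAt
  refine ⟨ε, hε, fun s hs hsε => ?_⟩
  have hmem : ∀ x y : ℂ, ‖x‖ ≤ s → ‖y‖ ≤ s → (x, y) ∈ ball (0 : ℂ × ℂ) ε := fun x y hx hy => by
    rw [mem_ball_zero_iff, Prod.norm_def]
    exact max_lt (hx.trans_lt hsε) (hy.trans_lt hsε)
  have hY : ∀ x, ‖x‖ ≤ s → ∀ y, ‖y‖ ≤ s → DifferentiableAt ℂ (fun y => f (x, y)) y := fun x hx y hy =>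
    (h _ (hmem x y hx hy)).differentiableAt.comp y (by fun_prop)
  have hX : ∀ x, ‖x‖ ≤ s → ∀ y, ‖y‖ ≤ s → DifferentiableAt ℂ (fun x => f (x, y)) x := fun x hx y hy =>
    DifferentiableAt.comp (f := fun x => (x, y)) x (h _ (hmem x y hx hy)).differentiableAt
      (by fun_prop)
  let F' : closedBall (0 : ℂ) s → DiscAlg s := fun x =>
    discOf (fun y => f (x, y))
      (fun y hy => (hY x (mem_closedBall_zero_iff.1 x.2) y (by simpa using hy)).continuousAt.continuousWithinAt)
      (fun y hy => (hY x (mem_closedBall_zero_iff.1 x.2) y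
        (by simpa using ball_subset_closedBall hy)).differentiableWithinAt)
  have hF'c : Continuous F' := by
    have hcont : Continuous fun p : closedBall (0 : ℂ) s × closedBall (0 : ℂ) s =>
        f ((p.1 : ℂ), (p.2 : ℂ)) := by
      rw [continuous_iff_continuousAt]
      intro p
      exact ContinuousAt.comp (f := fun p : closedBall (0 : ℂ) s × closedBall (0 : ℂ) s =>
        ((p.1 : ℂ), (p.2 : ℂ)))
        (h _ (hmem p.1 p.2 (mem_closedBall_zero_iff.1 p.1.2) (mem_closedBall_zero_iff.1 p.2.2))).continuousAt
        (by fun_prop)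
    exact Continuous.subtype_mk (ContinuousMap.curry ⟨_, hcont⟩).continuous _
  classical
  let F : ℂ → DiscAlg s := fun x => if hx : x ∈ closedBall (0 : ℂ) s then F' ⟨x, hx⟩ else 0
  have hFF' : ∀ x (hx : x ∈ closedBall (0 : ℂ) s), F x = F' ⟨x, hx⟩ := fun x hx => dif_pos hx
  refine ⟨F, ?_, ?_⟩
  · refine analyticAt_of_separating discEval (fun _ _ => disc_ext) hs ?_ fun y => ?_
    · rw [continuousOn_iff_continuous_domRestrict]
      have : (closedBall (0 : ℂ) s).domRestrict F = F' := funext fun x => hFF' x.1 x.2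
      rw [this]
      exact hF'c
    · refine DifferentiableOn.congr (f := fun x => f (x, y)) (fun x hx => ?_) fun x hx => ?_
      · exact (hX x (by simpa using ball_subset_closedBall hx) y
          (mem_closedBall_zero_iff.1 y.2)).differentiableWithinAt
      · rw [hFF' x (ball_subset_closedBall hx)]; rfl
  · filter_upwards [closedBall_mem_nhds (0 : ℂ) hs] with x hx y
    rw [hFF' x hx]; rfl

/-- A holomorphic family in the disc algebra comes from a holomorphic function of two variables. -/
theorem exists_analyticAt_of_disc_family {s : ℝ} (hs : 0 < s) {F : ℂ → DiscAlg s}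
    (hF : AnalyticAt ℂ F 0) :
    ∃ f : ℂ × ℂ → ℂ, AnalyticAt ℂ f 0 ∧
      ∃ ε > 0, ∀ x : ℂ, ∀ y : closedBall (0 : ℂ) s, ‖(y : ℂ)‖ < ε → discEval y (F x) = f (x, y) := by
  let Φ := divEquiv hs 1 (isUnit_one (M := DiscAlg s))
  -- `S` is the backward shift `g ↦ (g - g(0)) / y`. If `a = (1 - y S)⁻¹ g`, then comparing `a = g +
  -- y S a` with `a = (S a) · Y + a(0)` at the point `y` gives `g(y) = a(0)`, which is visibly
  -- analytic in `y`.
  let S : DiscAlg s →L[ℂ] DiscAlg s := (ContinuousLinearMap.fst ℂ _ _).comp Φ.symm.toContinuousLinearMap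
  have hS : ∀ g, g = S g * discY s + discEval (centre hs) g • 1 := fun g => by
    have h1 : divMap s 1 (discY s ^ 1 * 1) (Φ.symm g) = g := Φ.apply_symm_apply g
    rw [← Prod.mk.eta (p := Φ.symm g), divMap_apply] at h1
    simp only [pow_one, mul_one, Finset.univ_unique, Fin.default_eq_zero, Fin.val_zero, pow_zero,
      Finset.sum_singleton] at h1
    have h2 := congrArg (discEval (centre hs)) h1
    simp only [discEval_add, discEval_mul, discEval_discY, map_smul, coe_centre, mul_zero,
      zero_add, discEval_one, smul_eq_mul, mul_one] at h2
    rw [h2] at h1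
    exact h1.symm
  refine ⟨fun p => discEval (centre hs) (Ring.inverse (1 - p.2 • S) (F p.1)),
    ((discEval (centre hs)).analyticAt _).fun_comp (analyticAt_resolvent_apply S hF),
    (‖S‖ + 1)⁻¹, by positivity, fun x y hy => ?_⟩
  have h1 := congrArg (discEval y) (resolvent_apply S hy (F x))
  have h2 := congrArg (discEval y) (hS (Ring.inverse (1 - (y : ℂ) • S) (F x)))
  simp only [discEval_add, discEval_mul, discEval_discY, map_smul, discEval_one, smul_eq_mul,
    mul_one] at h1 h2
  linear_combination h2 - h1

/-- Weierstrass division: every germ is, modulo a germ `f` whose restriction to the `y`-axis has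
order `d`, a polynomial of degree less than `d` in `y`. -/
theorem weierstrass_division {f : O₂} {d : ℕ} {u : O₁} (hu : IsUnit u) (h : restrY f = T ^ d * u)
    (g : O₂) :
    ∃ (q : O₂) (c : Fin d → O₁), g = q * f + ∑ j : Fin d, liftX (c j) * Y ^ (j : ℕ) := by
  obtain ⟨f, hf, rfl⟩ := exists_germ₂ f
  obtain ⟨g, hg, rfl⟩ := exists_germ₂ g
  obtain ⟨u, hu', rfl⟩ := exists_germ₁ u
  have hu0 : u 0 ≠ 0 := (isUnit_iff_evalZeroLine _).1 hu
  have hT : T ^ d = germ₁ (id ^ d) (analyticAt_id.pow d) := rfl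
  rw [hT, restr_germ₂, germ₁_mul, germ₁_eq_iff] at h
  have h' : ∀ᶠ y in 𝓝 (0 : ℂ), f (0, y) = y ^ d * u y ∧ u y ≠ 0 ∧ DifferentiableAt ℂ u y := by
    filter_upwards [h, hu'.continuousAt.eventually_ne hu0, hu'.eventually_analyticAt]
      with y h1 h2 h3
    exact ⟨by simpa using h1, h2, h3.differentiableAt⟩
  obtain ⟨ε₁, hε₁, h1⟩ := Metric.eventually_nhds_iff_ball.1 h'
  obtain ⟨ε₂, hε₂, h2⟩ := exists_disc_family hf
  obtain ⟨ε₃, hε₃, h3⟩ := exists_disc_family hg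
  obtain ⟨s, hs, hsε⟩ := exists_between (lt_min hε₁ (lt_min hε₂ hε₃))
  simp only [lt_min_iff] at hsε
  obtain ⟨F, hF, hFf⟩ := h2 s hs hsε.2.1
  obtain ⟨G, hG, hGg⟩ := h3 s hs hsε.2.2
  have hK : ∀ y ∈ closedBall (0 : ℂ) s, y ∈ ball (0 : ℂ) ε₁ :=
    fun y hy => closedBall_subset_ball hsε.1 hy
  let U : DiscAlg s := discOf u
    (fun y hy => (h1 y (hK y hy)).2.2.continuousAt.continuousWithinAt)
    (fun y hy => (h1 y (hK y (ball_subset_closedBall hy))).2.2.differentiableWithinAt)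
  let V : DiscAlg s := discOf u⁻¹
    (fun y hy => ((h1 y (hK y hy)).2.2.inv (h1 y (hK y hy)).2.1).continuousAt.continuousWithinAt)
    (fun y hy => ((h1 y (hK y (ball_subset_closedBall hy))).2.2.inv
      (h1 y (hK y (ball_subset_closedBall hy))).2.1).differentiableWithinAt)
  have hU : IsUnit U := IsUnit.of_mul_eq_one V (disc_ext fun y =>
    mul_inv_cancel₀ (h1 y (hK y y.2)).2.1)
  -- At `x = 0` the equation to solve is division by `yᵈ u`, already known to be uniquely solvable.
  have hF0 : F 0 = discY s ^ d * U := disc_ext fun y => by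
    rw [hFf.self_of_nhds y, (h1 y (hK y y.2)).1]
    rfl
  obtain ⟨Q, c, hQ, hc', hsol⟩ := exists_analyticAt_solution (discPoly s d) hF hG (divEquiv hs d hU)
    (fun p => by rw [hF0]; rfl)
  obtain ⟨q, hq, ε, hε, hqP⟩ := exists_analyticAt_of_disc_family hs hQ
  have hc : ∀ j, AnalyticAt ℂ (fun x => c x j) 0 := fun j =>
    ((ContinuousLinearMap.proj j : (Fin d → ℂ) →L[ℂ] ℂ).analyticAt _).fun_comp hc'
  refine ⟨germ₂ q hq, fun j => germ₁ _ (hc j), ?_⟩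
  have hsum : ∀ t : Finset (Fin d), ∑ j ∈ t, liftX (germ₁ _ (hc j)) * Y ^ (j : ℕ) =
      germ₂ (fun p => ∑ j ∈ t, c p.1 j * p.2 ^ (j : ℕ))
        (Finset.analyticAt_fun_sum _ fun j _ =>
          (AnalyticAt.fun_comp (g := fun x => c x j) (f := Prod.fst) (x := (0 : ℂ × ℂ))
            (by simpa using hc j) analyticAt_fst).mul
            (analyticAt_snd.pow _)) := by
    classical
    intro t
    induction t using Finset.induction_on with
    | empty => simp only [Finset.sum_empty]; rfl
    | insert j t hj ih =>
      simp only [Finset.sum_insert hj, ih]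
      rfl
  rw [hsum, germ₂_mul, germ₂_add, germ₂_eq_iff]
  have hx : Tendsto Prod.fst (𝓝 (0 : ℂ × ℂ)) (𝓝 0) := continuous_fst.tendsto _
  have hy : Tendsto Prod.snd (𝓝 (0 : ℂ × ℂ)) (𝓝 0) := continuous_snd.tendsto _
  filter_upwards [hx.eventually (hFf.and (hGg.and hsol)),
    hy.eventually (closedBall_mem_nhds (0 : ℂ) hs), hy.eventually (ball_mem_nhds (0 : ℂ) hε)]
    with p ⟨hp1, hp2, hp3⟩ hp4 hp5
  have h4 := congrArg (discEval ⟨p.2, hp4⟩) hp3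
  rw [hp2, discEval_add, discEval_mul, hp1, hqP _ _ (by simpa using hp5), discPoly_apply, map_sum] at h4
  simp only [map_smul, discEval_pow, discEval_discY, smul_eq_mul] at h4
  simp only [Pi.add_apply, Pi.mul_apply]
  rw [← h4, mul_comm (q _)]

end PlaneGerm

end

/-! ### Algebra of the local ring `O₂`, branches of the polar curve, and colengths. -/

noncomputable section

namespace PlaneGerm

/-! ### The maximal ideal -/

/-- The remainder of division by `Y` depends on `x` alone, so it equals the restriction to the
`x`-axis. -/
theorem Y_dvd_of_restr_eq_zero {g : O₂} (h : restr (1, 0) g = 0) : Y ∣ g := by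
  obtain ⟨q, c, hq⟩ := weierstrass_division (f := Y) (d := 1) isUnit_one (by simp) g
  have h1 := congrArg (restr (1, 0)) hq
  simp only [Finset.univ_unique, Fin.default_eq_zero, Fin.val_zero, pow_zero, mul_one,
    Finset.sum_singleton, map_add, map_mul, restr_Y, zero_smul, mul_zero, zero_add, h,
    restr_liftX] at h1
  refine ⟨q, ?_⟩
  rw [hq]
  simp [← h1, mul_comm]

/-- The exchange of the two coordinates. -/
def swapXY : (ℂ × ℂ) ≃L[ℂ] ℂ × ℂ := ContinuousLinearEquiv.prodComm ℂ ℂ ℂ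

theorem restr_pull_swapXY (g : O₂) : restr (1, 0) (pull swapXY g) = restrY g := by
  obtain ⟨f, hf, rfl⟩ := exists_germ₂ g
  rw [pull_germ₂, restr_germ₂, restr_germ₂]
  congr 1

theorem restrY_eq_zero_iff {g : O₂} : restrY g = 0 ↔ X ∣ g := by
  constructor
  · intro h
    have h1 : Y ∣ pullEquiv swapXY g := Y_dvd_of_restr_eq_zero (by
      rw [pullEquiv_apply, restr_pull_swapXY, h])
    have h2 := map_dvd (pullEquiv swapXY).symm h1
    rwa [AlgEquiv.symm_apply_apply] at h2
  · rintro ⟨c, rfl⟩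
    simp

/-- After removing the value at `0`, the restriction to the `y`-axis is a multiple of `T` and lifts
to a multiple of `Y`; what remains vanishes on the `y`-axis, hence is a multiple of `X`. -/
theorem exists_hadamard (φ : O₂) :
    ∃ a b : O₂, φ = algebraMap ℂ O₂ (evalZero φ) + (a * X + b * Y) := by
  set ψ := φ - algebraMap ℂ O₂ (evalZero φ) with hψ
  have h0 : evalZero ψ = 0 := by simp [hψ]
  have h1 : T ∣ restrY ψ := by rw [T_dvd_iff, evalZeroLine_restr, h0]
  obtain ⟨c, hc⟩ := h1
  have h2 : X ∣ ψ - Y * liftY c := by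
    rw [← restrY_eq_zero_iff, map_sub, map_mul, restrY_liftY, hc, restrY_Y, sub_self]
  obtain ⟨a, ha⟩ := h2
  refine ⟨a, liftY c, ?_⟩
  linear_combination ha - hψ

theorem X_mem : X ∈ 𝔪 := rfl
theorem Y_mem : Y ∈ 𝔪 := rfl

theorem 𝔪_eq_span : 𝔪 = Ideal.span {X, Y} := by
  refine le_antisymm (fun φ hφ => ?_) ?_
  · obtain ⟨a, b, h⟩ := exists_hadamard φ
    rw [mem_𝔪.1 hφ, map_zero, zero_add] at h
    exact Ideal.mem_span_pair.2 ⟨a, b, h.symm⟩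
  · rw [Ideal.span_le]
    rintro z (rfl | rfl)
    exacts [X_mem, Y_mem]

theorem 𝔪_fg : (𝔪).FG := by
  rw [𝔪_eq_span]
  exact Submodule.fg_span (Set.toFinite _)

/-- A derivation killing both coordinates takes values in all powers of the maximal ideal. -/
theorem derivation_mem_pow {M : Type*} [AddCommGroup M] [Module O₂ M] [Module ℂ M]
    [IsScalarTower ℂ O₂ M]
    (δ : Derivation ℂ O₂ M) (hX : δ X = 0) (hY : δ Y = 0) (k : ℕ) (φ : O₂) :
    δ φ ∈ 𝔪 ^ k • (⊤ : Submodule O₂ M) := by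
  induction k generalizing φ with
  | zero => simp
  | succ k ih =>
    obtain ⟨a, b, h⟩ := exists_hadamard φ
    rw [h]
    simp only [map_add, Derivation.map_algebraMap, Derivation.leibniz, hX, hY, smul_zero, zero_add]
    rw [pow_succ', ← smul_eq_mul, Submodule.smul_assoc]
    exact add_mem (Submodule.smul_mem_smul X_mem (ih a)) (Submodule.smul_mem_smul Y_mem (ih b))

theorem restr_mem_of_mem_pow (w : ℂ × ℂ) {k : ℕ} {φ : O₂} (h : φ ∈ 𝔪 ^ k) :
    T ^ k ∣ restr w φ := by
  have h1 : (𝔪).map (restr w) ≤ Ideal.span {T} := by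
    rw [Ideal.map_le_iff_le_comap]
    intro ψ hψ
    rw [Ideal.mem_comap, Ideal.mem_span_singleton, T_dvd_iff, evalZeroLine_restr]
    exact hψ
  have h2 : restr w φ ∈ Ideal.span {T} ^ k :=
    Ideal.pow_right_mono h1 k (by rw [← Ideal.map_pow]; exact Ideal.mem_map_of_mem _ h)
  rwa [Ideal.span_singleton_pow, Ideal.mem_span_singleton] at h2

theorem eq_zero_of_forall_T_pow_dvd {a : O₁} (h : ∀ k, T ^ k ∣ a) : a = 0 := by
  by_contra ha
  obtain ⟨n, u, hu, rfl⟩ := exists_eq_T_pow_mul a ha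
  have h1 := h (n + 1)
  rw [pow_succ, mul_dvd_mul_iff_left (pow_ne_zero _ T_ne_zero)] at h1
  exact not_isUnit_T (isUnit_of_dvd_unit h1 hu)

/-- Each point near the origin lies on a line through it, and the identity theorem on that line
carries the vanishing from the origin to the point. This reduces the vanishing of `⋂ 𝔪ᵏ` to one
variable. -/
theorem eq_zero_of_restr {φ : O₂} (h : ∀ w, restr w φ = 0) : φ = 0 := by
  obtain ⟨f, hf, rfl⟩ := exists_germ₂ φ
  obtain ⟨ε, hε, hball⟩ := Metric.eventually_nhds_iff_ball.1 hf.eventually_analyticAt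
  rw [germ₂_zero, germ₂_eq_iff]
  filter_upwards [Metric.ball_mem_nhds 0 hε] with z hz
  set U : Set ℂ := line z ⁻¹' Metric.ball 0 ε with hU
  have hUc : IsPreconnected U := by
    exact Convex.isPreconnected
      ((convex_ball (0 : ℂ × ℂ) ε).linear_preimage ((line z).toLinearMap.restrictScalars ℝ))
  have han : AnalyticOnNhd ℂ (f ∘ line z) U := fun t ht =>
    (hball _ ht).comp ((line z).analyticAt t)
  have h0 : (0 : ℂ) ∈ U := by simp [hU, hε]
  have h1 : (1 : ℂ) ∈ U := by simpa [hU] using hz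
  have hz0 := h z
  rw [restr_germ₂, germ₁_zero, germ₁_eq_iff] at hz0
  simpa using han.eqOn_zero_of_preconnected_of_eventuallyEq_zero hUc h0 hz0 h1

theorem eq_zero_of_forall_mem_pow {φ : O₂} (h : ∀ k, φ ∈ 𝔪 ^ k) : φ = 0 :=
  eq_zero_of_restr fun w => eq_zero_of_forall_T_pow_dvd fun k => restr_mem_of_mem_pow w (h k)

theorem exists_order {φ : O₂} (h : φ ≠ 0) : ∃ n, φ ∈ 𝔪 ^ n ∧ φ ∉ 𝔪 ^ (n + 1) := by
  by_contra! hn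
  refine h (eq_zero_of_forall_mem_pow fun k => ?_)
  induction k with
  | zero => simp
  | succ k ih => exact hn k ih

/-! ### Leading forms -/

/-- A polynomial in the coordinates. -/
def poly : MvPolynomial (Fin 2) ℂ →ₐ[ℂ] O₂ := MvPolynomial.aeval ![X, Y]

/-- By induction through `𝔪ⁿ⁺¹ = 𝔪 · 𝔪ⁿ`: the leading form of a product is the linear part of the
first factor times the leading form of the second. -/
theorem exists_leadingForm {n : ℕ} {φ : O₂} (h : φ ∈ 𝔪 ^ n) :
    ∃ p : MvPolynomial (Fin 2) ℂ, p.IsHomogeneous n ∧ φ - poly p ∈ 𝔪 ^ (n + 1) := by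
  induction n generalizing φ with
  | zero =>
    refine ⟨MvPolynomial.C (evalZero φ), MvPolynomial.isHomogeneous_C _ _, ?_⟩
    rw [zero_add, pow_one, mem_𝔪]
    simp [poly]
  | succ n ih =>
    rw [pow_succ'] at h
    induction h using Submodule.mul_induction_on' with
    | mem_mul_mem r hr s hs =>
      obtain ⟨p, hp, hps⟩ := ih hs
      obtain ⟨a, b, hab⟩ := exists_hadamard r
      rw [mem_𝔪.1 hr, map_zero, zero_add] at hab
      refine ⟨(MvPolynomial.C (evalZero a) * MvPolynomial.X 0 +
        MvPolynomial.C (evalZero b) * MvPolynomial.X 1) * p, ?_, ?_⟩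
      · rw [add_comm n 1]
        refine MvPolynomial.IsHomogeneous.mul (MvPolynomial.IsHomogeneous.add ?_ ?_) hp
        · exact MvPolynomial.isHomogeneous_C_mul_X _ _
        · exact MvPolynomial.isHomogeneous_C_mul_X _ _
      · set l := algebraMap ℂ O₂ (evalZero a) * X + algebraMap ℂ O₂ (evalZero b) * Y with hl
        have hrl : r - l ∈ 𝔪 ^ 2 := by
          have : r - l = (a - algebraMap ℂ O₂ (evalZero a)) * X +
              (b - algebraMap ℂ O₂ (evalZero b)) * Y := by rw [hab, hl]; ring
          rw [this, pow_two]
          exact add_mem (Ideal.mul_mem_mul (by simp [mem_𝔪]) X_mem)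
            (Ideal.mul_mem_mul (by simp [mem_𝔪]) Y_mem)
        have hpoly : poly ((MvPolynomial.C (evalZero a) * MvPolynomial.X 0 +
            MvPolynomial.C (evalZero b) * MvPolynomial.X 1) * p) = l * poly p := by
          simp [poly, hl]
        rw [hpoly, show r * s - l * poly p = r * (s - poly p) + (r - l) * s - (r - l) * (s - poly p)
          by ring]
        refine sub_mem (add_mem ?_ ?_) ?_
        · rw [pow_succ']
          exact Ideal.mul_mem_mul hr hps
        · rw [show n + 1 + 1 = 2 + n by ring, pow_add]
          exact Ideal.mul_mem_mul hrl hs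
        · refine Ideal.pow_le_pow_right (n := 2 + (n + 1)) (by omega) ?_
          rw [pow_add]
          exact Ideal.mul_mem_mul hrl hps
    | add r hr s hs h1 h2 =>
      obtain ⟨p, hp, hp'⟩ := h1
      obtain ⟨q, hq, hq'⟩ := h2
      refine ⟨p + q, hp.add hq, ?_⟩
      rw [map_add, show r + s - (poly p + poly q) = (r - poly p) + (s - poly q) by ring]
      exact add_mem hp' hq'

theorem restr_poly (w : ℂ × ℂ) {n : ℕ} {p : MvPolynomial (Fin 2) ℂ} (hp : p.IsHomogeneous n) :
    restr w (poly p) = MvPolynomial.eval ![w.1, w.2] p • T ^ n := by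
  have h1 : restr w (poly p) = MvPolynomial.aeval ![w.1 • T, w.2 • T] p := by
    rw [← AlgHom.comp_apply]
    congr 1
    refine MvPolynomial.algHom_ext fun i => ?_
    fin_cases i <;> simp [poly, restr_X, restr_Y]
  rw [h1, MvPolynomial.aeval_def, MvPolynomial.eval₂_eq', MvPolynomial.eval_eq', Finset.sum_smul]
  refine Finset.sum_congr rfl fun d hd => ?_
  have hdn : d 0 + d 1 = n := by
    have := hp (MvPolynomial.mem_support_iff.1 hd)
    rw [Finsupp.weight_apply, Finsupp.sum_fintype _ _ (by simp)] at this
    simpa [Fin.sum_univ_two] using this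
  simp only [Fin.prod_univ_two, Matrix.cons_val_zero, Matrix.cons_val_one,
    ← hdn, pow_add, Algebra.smul_def, map_mul, map_pow]
  ring

theorem eval_eq_zero_of_mem {n : ℕ} {p : MvPolynomial (Fin 2) ℂ} (hp : p.IsHomogeneous n) {φ : O₂}
    (h : φ - poly p ∈ 𝔪 ^ (n + 1)) (w : ℂ × ℂ) (hφ : T ^ (n + 1) ∣ restr w φ) :
    MvPolynomial.eval ![w.1, w.2] p = 0 := by
  have h1 := dvd_sub hφ (restr_mem_of_mem_pow w h)
  rw [← map_sub, sub_sub_cancel, restr_poly w hp, Algebra.smul_def, mul_comm, pow_succ,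
    mul_dvd_mul_iff_left (pow_ne_zero _ T_ne_zero), T_dvd_iff, evalZeroLine_algebraMap] at h1
  exact h1

/-- Along the line spanned by `w` the leading form appears as its value at `w` times `Tⁿ`, so all
its values vanish. -/
theorem leadingForm_eq_zero {n : ℕ} {p : MvPolynomial (Fin 2) ℂ} (hp : p.IsHomogeneous n) {φ : O₂}
    (h : φ - poly p ∈ 𝔪 ^ (n + 1)) (hφ : φ ∈ 𝔪 ^ (n + 1)) : p = 0 := by
  refine MvPolynomial.funext fun v => ?_
  have := eval_eq_zero_of_mem hp h (v 0, v 1) (restr_mem_of_mem_pow _ hφ)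
  have hv : v = ![v 0, v 1] := by ext i; fin_cases i <;> rfl
  rw [hv, map_zero]
  exact this

/-- Orders add because leading forms multiply in a polynomial ring, which is a domain. -/
theorem mul_notMem_pow {a b : ℕ} {φ ψ : O₂} (hφ : φ ∈ 𝔪 ^ a) (hφ' : φ ∉ 𝔪 ^ (a + 1))
    (hψ : ψ ∈ 𝔪 ^ b) (hψ' : ψ ∉ 𝔪 ^ (b + 1)) : φ * ψ ∉ 𝔪 ^ (a + b + 1) := by
  intro h
  obtain ⟨p, hp, hφp⟩ := exists_leadingForm hφ
  obtain ⟨q, hq, hψq⟩ := exists_leadingForm hψ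
  have h1 : φ * ψ - poly (p * q) ∈ 𝔪 ^ (a + b + 1) := by
    rw [map_mul, show φ * ψ - poly p * poly q = φ * (ψ - poly q) + (φ - poly p) * ψ -
      (φ - poly p) * (ψ - poly q) by ring]
    refine sub_mem (add_mem ?_ ?_) ?_
    · rw [add_assoc, pow_add]; exact Ideal.mul_mem_mul hφ hψq
    · rw [show a + b + 1 = (a + 1) + b by ring, pow_add]; exact Ideal.mul_mem_mul hφp hψ
    · refine Ideal.pow_le_pow_right (n := (a + 1) + (b + 1)) (by omega) ?_
      rw [pow_add]; exact Ideal.mul_mem_mul hφp hψq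
  rcases mul_eq_zero.1 (leadingForm_eq_zero (hp.mul hq) h1 h) with rfl | rfl
  · exact hφ' (by simpa using hφp)
  · exact hψ' (by simpa using hψq)

instance : IsDomain O₂ := by
  refine @NoZeroDivisors.to_isDomain _ _ _ ⟨fun {a b} h => ?_⟩
  by_contra! hab
  obtain ⟨n, hn, hn'⟩ := exists_order hab.1
  obtain ⟨k, hk, hk'⟩ := exists_order hab.2
  exact mul_notMem_pow hn hn' hk hk' (by rw [h]; exact zero_mem _)

/-- This computes the colon ideal `𝔪ᵏ : g = 𝔪ᵏ⁻ʳ` needed in `colength_mul_pow`. -/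
theorem mem_pow_of_mul_mem {r k : ℕ} {g u : O₂} (hg : g ∈ 𝔪 ^ r) (hg' : g ∉ 𝔪 ^ (r + 1))
    (h : u * g ∈ 𝔪 ^ k) : u ∈ 𝔪 ^ (k - r) := by
  by_contra hu
  have hu0 : u ≠ 0 := by rintro rfl; exact hu (zero_mem _)
  obtain ⟨a, ha, ha'⟩ := exists_order hu0
  have hak : a < k - r := by
    by_contra! hle
    exact hu (Ideal.pow_le_pow_right hle ha)
  exact mul_notMem_pow ha ha' hg hg' (Ideal.pow_le_pow_right (by omega) h)

/-! ### Derivations and the order filtration -/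

theorem dv_mem_pow (v : ℂ × ℂ) {k : ℕ} {φ : O₂} (h : φ ∈ 𝔪 ^ (k + 1)) : dv v φ ∈ 𝔪 ^ k := by
  induction k generalizing φ with
  | zero => simp
  | succ k ih =>
    rw [pow_succ'] at h
    induction h using Submodule.mul_induction_on' with
    | mem_mul_mem r hr s hs =>
      rw [dv_mul]
      refine add_mem ?_ (Ideal.mul_mem_right _ _ hs)
      rw [pow_succ']
      exact Ideal.mul_mem_mul hr (ih hs)
    | add r hr s hs h1 h2 =>
      rw [dv_add]
      exact add_mem h1 h2

theorem euler_mem_pow {k : ℕ} {φ : O₂} (h : φ ∈ 𝔪 ^ k) :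
    X * dx φ + Y * dy φ - (k : O₂) * φ ∈ 𝔪 ^ (k + 1) := by
  induction k generalizing φ with
  | zero =>
    simp only [Nat.cast_zero, zero_mul, sub_zero, zero_add, pow_one]
    exact add_mem (Ideal.mul_mem_right _ _ X_mem) (Ideal.mul_mem_right _ _ Y_mem)
  | succ k ih =>
    rw [pow_succ'] at h
    induction h using Submodule.mul_induction_on' with
    | mem_mul_mem r hr s hs =>
      obtain ⟨a, b, hab⟩ := exists_hadamard r
      rw [mem_𝔪.1 hr, map_zero, zero_add] at hab
      have h1 : X * dx r + Y * dy r - r ∈ 𝔪 ^ 2 := by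
        have hx : dx r = a + X * dx a + Y * dx b := by
          rw [dx_eq_dv, hab, dv_add, dv_mul, dv_mul, dv_X, dv_Y]
          simp [dx_eq_dv]
        have hy : dy r = b + X * dy a + Y * dy b := by
          rw [dy_eq_dv, hab, dv_add, dv_mul, dv_mul, dv_X, dv_Y]
          simp [dy_eq_dv]; ring
        rw [hx, hy, show X * (a + X * dx a + Y * dx b) + Y * (b + X * dy a + Y * dy b) - r =
          X * (X * dx a + Y * dx b) + Y * (X * dy a + Y * dy b) by rw [hab]; ring, pow_two]
        exact add_mem (Ideal.mul_mem_mul X_mem (add_mem (Ideal.mul_mem_right _ _ X_mem)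
          (Ideal.mul_mem_right _ _ Y_mem))) (Ideal.mul_mem_mul Y_mem
          (add_mem (Ideal.mul_mem_right _ _ X_mem) (Ideal.mul_mem_right _ _ Y_mem)))
      have h2 : X * dx (r * s) + Y * dy (r * s) - ((k + 1 : ℕ) : O₂) * (r * s) =
          r * (X * dx s + Y * dy s - (k : O₂) * s) + (X * dx r + Y * dy r - r) * s := by
        rw [dx_eq_dv, dy_eq_dv, dv_mul, dv_mul]
        simp only [dx_eq_dv, dy_eq_dv]
        push_cast
        ring
      rw [h2]
      refine add_mem ?_ ?_
      · rw [pow_succ']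
        exact Ideal.mul_mem_mul hr (ih hs)
      · rw [show k + 1 + 1 = 2 + k by ring, pow_add]
        exact Ideal.mul_mem_mul h1 hs
    | add r hr s hs h1 h2 =>
      have h3 := add_mem h1 h2
      convert h3 using 1
      rw [dx_eq_dv, dy_eq_dv, dv_add, dv_add]
      simp only [dx_eq_dv, dy_eq_dv]
      ring

/-- The commutator of two derivations is a derivation; it kills both coordinates, so its values lie
in every power of `𝔪`. -/
theorem dx_dy_comm (φ : O₂) : dx (dy φ) = dy (dx φ) := by
  rw [← sub_eq_zero]
  refine eq_zero_of_forall_mem_pow fun k => ?_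
  have h := derivation_mem_pow ⁅dvDer (1, 0), dvDer (0, 1)⁆
    (by rw [Derivation.commutator_apply]; simp only [dvDer_apply, dv_X, dv_algebraMap, sub_self])
    (by rw [Derivation.commutator_apply]; simp only [dvDer_apply, dv_Y, dv_algebraMap, sub_self])
    k φ
  simpa [Derivation.commutator_apply, dvDer_apply, dx_eq_dv, dy_eq_dv] using h

/-- Were both partial derivatives of too high an order, Euler's relation would put `(n + 1) φ` into
`𝔪ⁿ⁺²`, and `n + 1` is invertible. With `algMultiplicity_eq` this identifies the Taylor order with
the `𝔪`-adic order. -/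
theorem exists_deriv_ne_zero {n : ℕ} {φ : O₂} (h : φ ∈ 𝔪 ^ n) (h' : φ ∉ 𝔪 ^ (n + 1)) :
    ∃ i j : ℕ, i + j = n ∧ evalZero (dx^[i] (dy^[j] φ)) ≠ 0 := by
  induction n generalizing φ with
  | zero => exact ⟨0, 0, rfl, by simpa [mem_𝔪] using h'⟩
  | succ n ih =>
    by_cases hy : dy φ ∈ 𝔪 ^ (n + 1)
    · have hx : dx φ ∉ 𝔪 ^ (n + 1) := by
        intro hx
        have h1 : (((n + 1 : ℕ) : O₂)) * φ ∈ 𝔪 ^ (n + 1 + 1) := by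
          have h2 : X * dx φ + Y * dy φ ∈ 𝔪 ^ (n + 1 + 1) := by
            rw [pow_succ' _ (n + 1)]
            exact add_mem (Ideal.mul_mem_mul X_mem hx) (Ideal.mul_mem_mul Y_mem hy)
          simpa using sub_mem h2 (euler_mem_pow h)
        refine h' ((Ideal.unit_mul_mem_iff_mem _ ?_).1 h1)
        rw [isUnit_iff_evalZero, map_natCast]
        exact Nat.cast_ne_zero.2 (Nat.succ_ne_zero n)
      obtain ⟨i, j, hij, hne⟩ := ih (dv_mem_pow _ h) hx
      refine ⟨i + 1, j, by omega, ?_⟩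
      have hc : ∀ (j : ℕ) (ψ : O₂), dx (dy^[j] ψ) = dy^[j] (dx ψ) := fun j ψ =>
        (Function.Commute.iterate_right (f := dx) (g := dy) dx_dy_comm j) ψ
      rwa [Function.iterate_succ_apply, hc]
    · obtain ⟨i, j, hij, hne⟩ := ih (dv_mem_pow _ h) hy
      exact ⟨i, j + 1, by omega, by rwa [Function.iterate_succ_apply]⟩

theorem iterate_dv_mem_pow (v : ℂ × ℂ) (j : ℕ) {k : ℕ} {φ : O₂} (h : φ ∈ 𝔪 ^ (k + j)) :
    (dv v)^[j] φ ∈ 𝔪 ^ k := by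
  induction j generalizing φ with
  | zero => exact h
  | succ j ih => exact ih (dv_mem_pow v h)

theorem algMultiplicity_eq {n : ℕ} {φ : O₂} (h : φ ∈ 𝔪 ^ n) (h' : φ ∉ 𝔪 ^ (n + 1)) :
    algMultiplicity φ = n := by
  refine le_antisymm (Nat.sInf_le (exists_deriv_ne_zero h h')) ?_
  refine le_csInf ⟨n, exists_deriv_ne_zero h h'⟩ ?_
  rintro _ ⟨i, j, rfl, hne⟩
  by_contra! hlt
  refine hne (mem_𝔪.1 ?_)
  rw [← pow_one 𝔪]
  refine iterate_dv_mem_pow (1, 0) i (iterate_dv_mem_pow (0, 1) j ?_)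
  exact Ideal.pow_le_pow_right (by omega) h

/-! ### Dimension counts for quotients -/

section LinearAlgebra

theorem finite_and_finrank_of_exact {K A B C : Type*} [Field K] [AddCommGroup A] [Module K A]
    [AddCommGroup B] [Module K B] [AddCommGroup C] [Module K C] (f : A →ₗ[K] B) (g : B →ₗ[K] C)
    (hf : Function.Injective f) (hg : Function.Surjective g) (h : Function.Exact f g)
    [Module.Finite K A] [Module.Finite K C] :
    Module.Finite K B ∧ Module.finrank K B = Module.finrank K A + Module.finrank K C := by
  have hB : Module.Finite K B := Module.Finite.of_exact h hg
  refine ⟨hB, ?_⟩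
  have h1 := g.finrank_range_add_finrank_ker
  rw [LinearMap.range_eq_top.2 hg, finrank_top, h.linearMap_ker_eq,
    LinearMap.finrank_range_of_inj hf] at h1
  omega

variable {S : Type*} [CommRing S] [Algebra ℂ S]

/-- If `h` is not a zero divisor, also modulo `b`, the colength of `(h g, b)` is the sum of the
colengths of `(g, b)` and `(h, b)`. -/
theorem colength_mul [IsDomain S] {h g b : S} (h0 : h ≠ 0) (hb : ∀ c, h ∣ b * c → h ∣ c)
    [hfg : Module.Finite ℂ (S ⧸ Ideal.span {g, b})] [hfh : Module.Finite ℂ (S ⧸ Ideal.span {h, b})] :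
    Module.Finite ℂ (S ⧸ Ideal.span {h * g, b}) ∧
      Module.finrank ℂ (S ⧸ Ideal.span {h * g, b}) =
        Module.finrank ℂ (S ⧸ Ideal.span {g, b}) + Module.finrank ℂ (S ⧸ Ideal.span {h, b}) := by
  have hle : Ideal.span {g, b} ≤
      Submodule.comap (LinearMap.mulLeft S h) (Ideal.span {h * g, b}) := by
    rw [Ideal.span_le]
    rintro z (rfl | rfl)
    · exact Ideal.subset_span (by simp)
    · exact Ideal.mul_mem_left _ _ (Ideal.subset_span (by simp))
  have hle2 : Ideal.span {h * g, b} ≤ Ideal.span {h, b} := by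
    rw [Ideal.span_le]
    rintro z (rfl | rfl)
    · exact Ideal.mul_mem_right _ _ (Ideal.subset_span (by simp))
    · exact Ideal.subset_span (by simp)
  -- The count comes from `0 → S/(g, b) → S/(hg, b) → S/(h, b) → 0`, the first map being
  -- multiplication by `h`.
  let φ : (S ⧸ Ideal.span {g, b}) →ₗ[S] S ⧸ Ideal.span {h * g, b} :=
    Submodule.mapQ _ _ (LinearMap.mulLeft S h) hle
  let ψ : (S ⧸ Ideal.span {h * g, b}) →ₗ[S] S ⧸ Ideal.span {h, b} := Submodule.factor hle2
  have hφ : ∀ a, φ (Submodule.Quotient.mk a) = Submodule.Quotient.mk (h * a) := fun a => rfl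
  have hψ : ∀ a, ψ (Submodule.Quotient.mk a) = Submodule.Quotient.mk a := fun a => rfl
  refine finite_and_finrank_of_exact (φ.restrictScalars ℂ) (ψ.restrictScalars ℂ) ?_ ?_ ?_
  · refine (injective_iff_map_eq_zero φ).2 fun a ha => ?_
    obtain ⟨a, rfl⟩ := Submodule.Quotient.mk_surjective _ a
    rw [hφ, Submodule.Quotient.mk_eq_zero, Ideal.mem_span_pair] at ha
    rw [Submodule.Quotient.mk_eq_zero, Ideal.mem_span_pair]
    obtain ⟨c, e, hce⟩ := ha
    obtain ⟨e', rfl⟩ := hb e ⟨a - c * g, by linear_combination hce⟩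
    exact ⟨c, e', mul_left_cancel₀ h0 (by linear_combination hce)⟩
  · exact Submodule.factor_surjective hle2
  · intro a
    obtain ⟨a, rfl⟩ := Submodule.Quotient.mk_surjective _ a
    change ψ (Submodule.Quotient.mk a) = 0 ↔ Submodule.Quotient.mk a ∈ Set.range φ
    rw [hψ, Submodule.Quotient.mk_eq_zero, Ideal.mem_span_pair]
    constructor
    · rintro ⟨c, e, rfl⟩
      refine ⟨Submodule.Quotient.mk c, ?_⟩
      rw [hφ, Submodule.Quotient.eq, Ideal.mem_span_pair]
      exact ⟨0, -e, by ring⟩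
    · rintro ⟨c, hc⟩
      obtain ⟨c, rfl⟩ := Submodule.Quotient.mk_surjective _ c
      rw [hφ, Submodule.Quotient.eq, Ideal.mem_span_pair] at hc
      obtain ⟨p, q, hpq⟩ := hc
      exact ⟨c - p * g, -q, by linear_combination -hpq⟩

theorem finite_quotient_of_le {I J : Ideal S} (h : I ≤ J) [Module.Finite ℂ (S ⧸ I)] :
    Module.Finite ℂ (S ⧸ J) :=
  Module.Finite.of_surjective (Ideal.Quotient.factorₐ ℂ h).toLinearMap
    (Ideal.Quotient.factor_surjective h)

end LinearAlgebra

theorem exists_fg_add_mem_pow (N : ℕ) :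
    ∃ W : Submodule ℂ O₂, W.FG ∧ ∀ φ : O₂, ∃ ψ ∈ W, φ - ψ ∈ 𝔪 ^ N := by
  induction N with
  | zero => exact ⟨⊥, Submodule.fg_bot, fun φ => ⟨0, zero_mem _, by simp⟩⟩
  | succ N ih =>
    obtain ⟨W, hW, h⟩ := ih
    refine ⟨Submodule.span ℂ {1} ⊔ (W.map (LinearMap.mulRight ℂ X) ⊔ W.map (LinearMap.mulRight ℂ Y)),
      (Submodule.fg_span_singleton _).sup ((hW.map _).sup (hW.map _)), fun φ => ?_⟩
    obtain ⟨a, b, hab⟩ := exists_hadamard φ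
    obtain ⟨a', ha', haN⟩ := h a
    obtain ⟨b', hb', hbN⟩ := h b
    refine ⟨algebraMap ℂ O₂ (evalZero φ) + (a' * X + b' * Y),
      Submodule.add_mem_sup ?_ (Submodule.add_mem_sup (Submodule.mem_map_of_mem ha')
        (Submodule.mem_map_of_mem hb')), ?_⟩
    · rw [Algebra.algebraMap_eq_smul_one]
      exact Submodule.smul_mem _ _ (Submodule.mem_span_singleton_self _)
    · nth_rw 1 [hab]
      rw [show ∀ c : O₂, c + (a * X + b * Y) - (c + (a' * X + b' * Y)) =
        (a - a') * X + (b - b') * Y from fun c => by ring, pow_succ]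
      exact add_mem (Ideal.mul_mem_mul haN X_mem) (Ideal.mul_mem_mul hbN Y_mem)

instance finite_quotient_pow (N : ℕ) : Module.Finite ℂ (O₂ ⧸ 𝔪 ^ N) := by
  obtain ⟨W, hW, h⟩ := exists_fg_add_mem_pow N
  have : Module.Finite ℂ W := Module.Finite.iff_fg.2 hW
  refine Module.Finite.of_surjective
    ((Ideal.Quotient.mkₐ ℂ (𝔪 ^ N)).toLinearMap.comp W.subtype) fun a => ?_
  obtain ⟨φ, rfl⟩ := Ideal.Quotient.mk_surjective a
  obtain ⟨ψ, hψ, hN⟩ := h φ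
  exact ⟨⟨ψ, hψ⟩, (Ideal.Quotient.eq.2 (by simpa using neg_mem hN))⟩

theorem finrank_quotient_𝔪 : Module.finrank ℂ (O₂ ⧸ 𝔪) = 1 := by
  have : Nontrivial (O₂ ⧸ 𝔪) := Ideal.Quotient.nontrivial_iff.2 𝔪_isMaximal.ne_top
  refine finrank_eq_one (1 : O₂ ⧸ 𝔪) one_ne_zero fun a => ?_
  · obtain ⟨φ, rfl⟩ := Ideal.Quotient.mk_surjective a
    refine ⟨evalZero φ, ?_⟩
    refine Ideal.Quotient.eq.2 (?_ : evalZero φ • (1 : O₂) - φ ∈ 𝔪)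
    simp [mem_𝔪, Algebra.smul_def]

theorem finite_of_primes {I : Ideal O₂} (h : ∀ p : Ideal O₂, p.IsPrime → I ≤ p → p = 𝔪) :
    ∃ N, 𝔪 ^ N ≤ I := by
  refine Ideal.exists_pow_le_of_le_radical_of_fg ?_ 𝔪_fg
  rw [Ideal.radical_eq_sInf]
  exact le_sInf fun p hp => (h p hp.2 hp.1).ge

/-! ### Germs that are regular in `y` -/

/-- The restriction of `g` to the `y`-axis has order `d`. -/
def YRegular (g : O₂) (d : ℕ) : Prop := ∃ u : O₁, IsUnit u ∧ restrY g = T ^ d * u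

theorem exists_yRegular {g : O₂} (h : ¬ X ∣ g) : ∃ d, YRegular g d := by
  obtain ⟨d, u, hu, hd⟩ := exists_eq_T_pow_mul (restrY g) (fun h0 => h (restrY_eq_zero_iff.1 h0))
  exact ⟨d, u, hu, hd⟩

theorem YRegular.not_X_dvd {g : O₂} {d : ℕ} (h : YRegular g d) : ¬ X ∣ g := by
  rw [← restrY_eq_zero_iff]
  obtain ⟨u, hu, h⟩ := h
  rw [h]
  exact T_pow_mul_ne_zero d hu

theorem YRegular.ne_zero {g : O₂} {d : ℕ} (h : YRegular g d) : g ≠ 0 := by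
  rintro rfl
  exact h.not_X_dvd (dvd_zero _)

theorem isUnit_liftY {u : O₁} (hu : IsUnit u) : IsUnit (liftY u) := hu.map liftY

theorem YRegular.exists_eq {g : O₂} {d : ℕ} (h : YRegular g d) :
    ∃ v c : O₂, IsUnit v ∧ g = Y ^ d * v + X * c := by
  obtain ⟨u, hu, h⟩ := h
  have h1 : X ∣ g - Y ^ d * liftY u := by
    rw [← restrY_eq_zero_iff, map_sub, map_mul, map_pow, restrY_liftY, restrY_Y, h, sub_self]
  obtain ⟨c, hc⟩ := h1
  exact ⟨liftY u, c, isUnit_liftY hu, by linear_combination hc⟩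

theorem yRegular_iff_exists {g : O₂} {d : ℕ} :
    YRegular g d ↔ ∃ v c : O₂, IsUnit v ∧ g = Y ^ d * v + X * c := by
  refine ⟨fun h => h.exists_eq, ?_⟩
  rintro ⟨v, c, hv, rfl⟩
  exact ⟨restrY v, hv.map restrY, by simp⟩

theorem T_pow_mul_eq {a b : ℕ} {u v : O₁} (hu : IsUnit u) (hv : IsUnit v)
    (h : T ^ a * u = T ^ b * v) : a = b := by
  wlog hab : a < b generalizing a b u v
  · rcases lt_trichotomy a b with h1 | h1 | h1
    exacts [absurd h1 hab, h1, (this hv hu h.symm h1).symm]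
  obtain ⟨k, rfl⟩ := Nat.exists_eq_add_of_lt hab
  rw [show T ^ (a + k + 1) * v = T ^ a * (T * (T ^ k * v)) by ring] at h
  have h1 := mul_left_cancel₀ (pow_ne_zero _ T_ne_zero) h
  exact absurd (isUnit_of_dvd_unit ⟨_, h1⟩ hu) not_isUnit_T

theorem YRegular.unique {g : O₂} {a b : ℕ} (h : YRegular g a) (h' : YRegular g b) : a = b := by
  obtain ⟨u, hu, h⟩ := h
  obtain ⟨v, hv, h'⟩ := h'
  exact T_pow_mul_eq hu hv (h.symm.trans h')

theorem YRegular.mul {g h : O₂} {a b : ℕ} (hg : YRegular g a) (hh : YRegular h b) :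
    YRegular (g * h) (a + b) := by
  obtain ⟨u, hu, hg⟩ := hg
  obtain ⟨v, hv, hh⟩ := hh
  exact ⟨u * v, hu.mul hv, by rw [map_mul, hg, hh]; ring⟩

theorem YRegular.isUnit_iff {g : O₂} {d : ℕ} (h : YRegular g d) : IsUnit g ↔ d = 0 := by
  obtain ⟨u, hu, h⟩ := h
  rw [isUnit_iff_evalZero, ← evalZeroLine_restr (0, 1), ← isUnit_iff_evalZeroLine, h]
  constructor
  · intro h1
    by_contra hd
    exact not_isUnit_T (isUnit_of_dvd_unit ((dvd_pow_self T hd).mul_right u) h1)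
  · rintro rfl
    simpa using hu

theorem YRegular.dy {g : O₂} {d : ℕ} (h : YRegular g (d + 1)) : YRegular (dy g) d := by
  rw [yRegular_iff_exists] at h
  obtain ⟨v, c, hv, rfl⟩ := h
  refine ⟨restrY (((d + 1 : ℕ) : O₂) * v + Y * PlaneGerm.dy v), ?_, ?_⟩
  · rw [isUnit_iff_evalZeroLine, evalZeroLine_restr, map_add, map_mul, map_mul, mem_𝔪.1 Y_mem,
      zero_mul, add_zero, map_natCast]
    exact mul_ne_zero (Nat.cast_ne_zero.2 d.succ_ne_zero) ((isUnit_iff_evalZero v).1 hv)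
  · have h1 : PlaneGerm.dy (Y ^ (d + 1)) = ((d + 1 : ℕ) : O₂) * Y ^ d := by
      have := (dvDer (0, 1)).leibniz_pow Y (d + 1)
      rw [dvDer_apply, dvDer_apply, dv_Y] at this
      simpa [dy_eq_dv] using this
    have h2 : PlaneGerm.dy (Y ^ (d + 1) * v + X * c) =
        Y ^ d * (((d + 1 : ℕ) : O₂) * v + Y * PlaneGerm.dy v) + X * PlaneGerm.dy c := by
      rw [dy_eq_dv, dv_add, dv_mul, dv_mul, dv_X]
      simp only [← dy_eq_dv]
      rw [h1]
      simp only [map_zero, mul_zero, add_zero]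
      ring
    rw [h2]
    simp

/-! ### Prime ideals of height one -/

instance algebraO₁O₂ : Algebra O₁ O₂ := liftX.toRingHom.toAlgebra

instance : IsScalarTower ℂ O₁ O₂ := IsScalarTower.of_algebraMap_eq fun c => (liftX.commutes c).symm

theorem YRegular.finite {g : O₂} {d : ℕ} (h : YRegular g d) :
    Module.Finite O₁ (O₂ ⧸ Ideal.span {g}) := by
  classical
  obtain ⟨u, hu, h⟩ := h
  refine ⟨⟨Finset.univ.image fun j : Fin d => Ideal.Quotient.mk _ (Y ^ (j : ℕ)), ?_⟩⟩
  rw [eq_top_iff]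
  rintro a -
  obtain ⟨φ, rfl⟩ := Ideal.Quotient.mk_surjective a
  obtain ⟨q, c, hq⟩ := weierstrass_division hu h φ
  have h1 : Ideal.Quotient.mk (Ideal.span {g}) φ =
      ∑ j : Fin d, c j • Ideal.Quotient.mk (Ideal.span {g}) (Y ^ (j : ℕ)) := by
    rw [hq, map_add, map_sum, Ideal.Quotient.eq_zero_iff_mem.2
      (Ideal.mul_mem_left _ q (Ideal.mem_span_singleton_self g)), zero_add]
    rfl
  rw [h1]
  exact Submodule.sum_mem _ fun j _ => Submodule.smul_mem _ _ (Submodule.subset_span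
    (Finset.mem_coe.2 (Finset.mem_image_of_mem _ (Finset.mem_univ j))))

/-- Weierstrass division makes `O₂ / (g)` finite over `O₁`, hence Noetherian; adding the generator
`g` gives the ideal itself. -/
theorem YRegular.fg_of_mem {g : O₂} {d : ℕ} (h : YRegular g d) {I : Ideal O₂} (hI : g ∈ I) :
    I.FG := by
  have := h.finite
  have hN : IsNoetherian O₂ (O₂ ⧸ Ideal.span {g}) := isNoetherian_of_tower O₁ inferInstance
  refine Submodule.fg_of_fg_map_of_fg_inf_ker (Ideal.span {g}).mkQ (IsNoetherian.noetherian _) ?_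
  rw [Submodule.ker_mkQ, inf_eq_right.2 ((Ideal.span_singleton_le_iff_mem _).2 hI)]
  exact Submodule.fg_span_singleton g

/-- Modulo `X` the germ `g` is a unit times `Yᵈ`, so a prime containing `X` and `g` contains `Y` as
well. -/
theorem X_notMem_of_prime {g : O₂} {d : ℕ} (h : YRegular g d) {p : Ideal O₂} [hp : p.IsPrime]
    (hg : g ∈ p) (hpm : p ≠ 𝔪) : X ∉ p := by
  intro hX
  obtain ⟨v, c, hv, rfl⟩ := h.exists_eq
  have h1 : Y ^ d * v ∈ p := (Ideal.add_mem_iff_left _ (Ideal.mul_mem_right _ _ hX)).1 hg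
  have h2 : Y ∈ p := hp.mem_of_pow_mem d ((Ideal.mul_unit_mem_iff_mem _ hv).1 h1)
  refine hpm (le_antisymm (le_𝔪 hp.ne_top) ?_)
  rw [𝔪_eq_span, Ideal.span_le]
  rintro z (rfl | rfl)
  exacts [hX, h2]

/-- A prime ideal other than the maximal one that contains a germ regular in `y` is principal. -/
theorem exists_eq_span_of_prime {g : O₂} {d : ℕ} (h : YRegular g d) {p : Ideal O₂} [hp : p.IsPrime]
    (hg : g ∈ p) (hpm : p ≠ 𝔪) : ∃ q, Prime q ∧ p = Ideal.span {q} := by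
  have hX := X_notMem_of_prime h hg hpm
  obtain ⟨t, ht⟩ := IsPrincipalIdealRing.principal (p.map restrY)
  have htm : t ∈ p.map restrY := by rw [ht]; exact Submodule.mem_span_singleton_self t
  obtain ⟨q, hq, rfl⟩ := (Ideal.mem_map_iff_of_surjective _ restrY_surjective).1 htm
  -- Nakayama: `q` generates `p` on the `y`-axis, and an element of `p` vanishing there is `X b`
  -- with `b ∈ p` since `X ∉ p`. Thus `p ⊆ (q) + 𝔪 p`.
  have hle : p ≤ Ideal.span {q} := by
    refine Submodule.le_of_le_smul_of_le_jacobson_bot (I := 𝔪) (h.fg_of_mem hg) ?_ ?_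
    · rw [← maximalIdeal_eq]
      exact IsLocalRing.maximalIdeal_le_jacobson _
    · intro a ha
      have h1 : restrY a ∈ Submodule.span O₁ {restrY q} := by
        rw [← ht]; exact Ideal.mem_map_of_mem _ ha
      obtain ⟨c, hc⟩ := Submodule.mem_span_singleton.1 h1
      have h2 : X ∣ a - q * liftY c := by
        rw [← restrY_eq_zero_iff, map_sub, map_mul, restrY_liftY, ← hc, smul_eq_mul, mul_comm,
          sub_self]
      obtain ⟨b, hb⟩ := h2
      have h3 : X * b ∈ p := hb ▸ sub_mem ha (Ideal.mul_mem_right _ _ hq)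
      have h4 : b ∈ p := (hp.mem_or_mem h3).resolve_left hX
      rw [show a = q * liftY c + X * b by linear_combination hb]
      exact Submodule.add_mem_sup (Ideal.mul_mem_right _ _ (Ideal.mem_span_singleton_self q))
        (Submodule.smul_mem_smul X_mem h4)
  have hpq : p = Ideal.span {q} := le_antisymm hle ((Ideal.span_singleton_le_iff_mem _).2 hq)
  refine ⟨q, ?_, hpq⟩
  have hq0 : q ≠ 0 := by
    rintro rfl
    rw [hpq, Ideal.mem_span_singleton, zero_dvd_iff] at hg
    exact h.ne_zero hg
  rw [← Ideal.span_singleton_prime hq0, ← hpq]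
  exact hp

theorem not_dvd_X_pow {g : O₂} {d : ℕ} (h : YRegular g d) (hg : g ∈ 𝔪) (n : ℕ) : ¬ g ∣ X ^ n := by
  induction n with
  | zero =>
    rw [pow_zero]
    exact fun h1 => isUnit_iff_notMem.1 (isUnit_of_dvd_one h1) hg
  | succ n ih =>
    rintro ⟨c, hc⟩
    have h1 : restrY g * restrY c = 0 := by
      rw [← map_mul, ← hc]
      simp
    rcases mul_eq_zero.1 h1 with h2 | h2
    · exact h.not_X_dvd (restrY_eq_zero_iff.1 h2)
    · obtain ⟨e, rfl⟩ := restrY_eq_zero_iff.1 h2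
      refine ih ⟨e, mul_left_cancel₀ (a := X) ?_ (by linear_combination hc)⟩
      intro h0
      have hXT : restr (1, 0) X = T := by simp [restr_X]
      rw [h0, map_zero] at hXT
      exact T_ne_zero hXT.symm

/-- A prime containing `g` and avoiding the powers of `X` is not `𝔪`, hence is generated by a prime
factor of `g`. -/
theorem exists_prime_dvd {g : O₂} {d : ℕ} (h : YRegular g d) (hg : g ∈ 𝔪) :
    ∃ q, Prime q ∧ q ∣ g := by
  have hdisj : Disjoint (Ideal.span {g} : Set O₂) (Submonoid.powers X : Submonoid O₂) := by
    rw [Set.disjoint_left]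
    rintro a ha ⟨n, rfl⟩
    exact not_dvd_X_pow h hg n (Ideal.mem_span_singleton.1 ha)
  obtain ⟨p, hp, hle, hd⟩ := Ideal.exists_le_prime_disjoint _ _ hdisj
  have hX : X ∉ p := fun hX => Set.disjoint_left.1 hd hX (Submonoid.mem_powers X)
  have hgp : g ∈ p := hle (Ideal.mem_span_singleton_self g)
  obtain ⟨q, hq, rfl⟩ := exists_eq_span_of_prime h hgp (fun hpm => hX (hpm ▸ X_mem))
  exact ⟨q, hq, Ideal.mem_span_singleton.1 hgp⟩

theorem YRegular.of_dvd {g h : O₂} {d : ℕ} (hg : YRegular g d) (hd : h ∣ g) :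
    ∃ e, YRegular h e :=
  exists_yRegular fun hX => hg.not_X_dvd (hX.trans hd)

/-- Induction on the number of prime factors of a germ regular in `y`. -/
theorem YRegular.induction {P : O₂ → Prop} (hunit : ∀ u, IsUnit u → P u)
    (hmul : ∀ q g, Prime q → P g → P (q * g)) {g : O₂} {d : ℕ} (h : YRegular g d) : P g := by
  induction d using Nat.strong_induction_on generalizing g with
  | _ d ih =>
    by_cases hu : IsUnit g
    · exact hunit g hu
    · obtain ⟨q, hq, c, rfl⟩ := exists_prime_dvd h (by rwa [isUnit_iff_notMem, not_not] at hu)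
      obtain ⟨a, ha⟩ := h.of_dvd (Dvd.intro _ rfl)
      obtain ⟨b, hb⟩ := h.of_dvd (Dvd.intro_left _ rfl)
      have hab := h.unique (ha.mul hb)
      -- Orders on the `y`-axis add and a prime has positive order, so the order of the cofactor
      -- drops strictly.
      have ha0 : a ≠ 0 := fun h0 => hq.not_isUnit (ha.isUnit_iff.2 h0)
      exact hmul q c hq (ih b (by omega) hb)

/-- A germ without common prime factors with a germ regular in `y` cuts out a finite scheme. -/
theorem exists_pow_le_of_coprime {g b : O₂} {d : ℕ} (h : YRegular g d)
    (hb : ∀ q, Prime q → q ∣ g → ¬ q ∣ b) : ∃ N, 𝔪 ^ N ≤ Ideal.span {g, b} := by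
  refine finite_of_primes fun p hp hle => ?_
  by_contra hpm
  have hgp : g ∈ p := hle (Ideal.subset_span (by simp))
  have hbp : b ∈ p := hle (Ideal.subset_span (by simp))
  obtain ⟨q, hq, rfl⟩ := exists_eq_span_of_prime h hgp hpm
  exact hb q hq (Ideal.mem_span_singleton.1 hgp) (Ideal.mem_span_singleton.1 hbp)

theorem finite_of_coprime {g b : O₂} {d : ℕ} (h : YRegular g d)
    (hb : ∀ q, Prime q → q ∣ g → ¬ q ∣ b) : Module.Finite ℂ (O₂ ⧸ Ideal.span {g, b}) := by
  obtain ⟨N, hN⟩ := exists_pow_le_of_coprime h hb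
  exact finite_quotient_of_le hN

theorem dvd_of_dvd_mul_of_coprime {g b : O₂} {d : ℕ} (h : YRegular g d)
    (hb : ∀ q, Prime q → q ∣ g → ¬ q ∣ b) (c : O₂) (hc : g ∣ b * c) : g ∣ c := by
  revert hb c
  refine YRegular.induction (P := fun g => (∀ q, Prime q → q ∣ g → ¬ q ∣ b) →
    ∀ c, g ∣ b * c → g ∣ c) (fun u hu _ c _ => hu.dvd) (fun q g hq ih hb c hc => ?_) h
  obtain ⟨c', rfl⟩ := (hq.dvd_or_dvd ((Dvd.intro _ rfl).trans hc)).resolve_left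
    (hb q hq (Dvd.intro _ rfl))
  rw [mul_left_comm, mul_dvd_mul_iff_left hq.ne_zero] at hc
  exact mul_dvd_mul_left q (ih (fun q' hq' hd => hb q' hq' (hd.mul_left q)) c' hc)

theorem X_ne_zero : X ≠ 0 := by
  intro h0
  have hXT : restr (1, 0) X = T := by simp [restr_X]
  rw [h0, map_zero] at hXT
  exact T_ne_zero hXT.symm

theorem Y_ne_zero : Y ≠ 0 := by
  intro h0
  have hXT : restrY Y = T := by simp
  rw [h0, map_zero] at hXT
  exact T_ne_zero hXT.symm

theorem colength_Y_pow_X (d : ℕ) : Module.Finite ℂ (O₂ ⧸ Ideal.span {Y ^ d, X}) ∧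
    Module.finrank ℂ (O₂ ⧸ Ideal.span {Y ^ d, X}) = d := by
  induction d with
  | zero =>
    have h1 : Ideal.span {Y ^ 0, X} = (⊤ : Ideal O₂) :=
      (Ideal.eq_top_iff_one _).2 (Ideal.subset_span (by simp))
    have : Subsingleton (O₂ ⧸ Ideal.span {Y ^ 0, X}) := Ideal.Quotient.subsingleton_iff.2 h1
    exact ⟨inferInstance, Module.finrank_zero_of_subsingleton⟩
  | succ d ih =>
    have h1 : Ideal.span {Y, X} = 𝔪 := by rw [𝔪_eq_span, Set.pair_comm]
    have hf : Module.Finite ℂ (O₂ ⧸ Ideal.span {Y, X}) := by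
      rw [h1, ← pow_one 𝔪]; infer_instance
    have hd : Module.finrank ℂ (O₂ ⧸ Ideal.span {Y, X}) = 1 := by
      rw [h1]; exact finrank_quotient_𝔪
    have := ih.1
    have h2 := colength_mul (h := Y) (g := Y ^ d) (b := X) Y_ne_zero fun c ⟨e, he⟩ => by
      refine Y_dvd_of_restr_eq_zero ?_
      have h3 := congrArg (restr (1, 0)) he
      simpa [restr_X, restr_Y, T_ne_zero] using h3
    rw [← pow_succ', ih.2, hd] at h2
    exact h2

theorem colength_X {g : O₂} {d : ℕ} (h : YRegular g d) :
    Module.Finite ℂ (O₂ ⧸ Ideal.span {g, X}) ∧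
      Module.finrank ℂ (O₂ ⧸ Ideal.span {g, X}) = d := by
  obtain ⟨v, c, hv, rfl⟩ := h.exists_eq
  have h1 : Ideal.span {Y ^ d * v + X * c, X} = Ideal.span {Y ^ d, X} := by
    refine le_antisymm ?_ ?_
    · rw [Ideal.span_le]
      rintro z (rfl | rfl)
      · exact Ideal.mem_span_pair.2 ⟨v, c, by ring⟩
      · exact Ideal.subset_span (by simp)
    · rw [Ideal.span_le]
      obtain ⟨w, hw⟩ := hv.exists_right_inv
      rintro z (rfl | rfl)
      · exact Ideal.mem_span_pair.2 ⟨w, -w * c, by linear_combination Y ^ d * hw⟩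
      · exact Ideal.subset_span (by simp)
  rw [h1]
  exact colength_Y_pow_X d

/-! ### Expansion of a discrete valuation ring in a uniformizer -/

section Expansion

open PowerSeries (C coeff_succ_X_mul X_pow_dvd_iff X_prime)
open scoped PowerSeries

variable {V : Type*} [CommRing V] [IsDomain V] [IsDiscreteValuationRing V] [Algebra ℂ V]

/-- A discrete valuation ring with coefficient field `ℂ` embeds into the ring of formal power
series, compatibly with divisibility. -/
theorem exists_expansion
    (hres : ∀ b : V, ∃ c : ℂ, b - algebraMap ℂ V c ∈ IsLocalRing.maximalIdeal V) :
    ∃ φ : V →ₐ[ℂ] ℂ⟦X⟧, Function.Injective φ ∧ ∀ a b, φ a ∣ φ b → a ∣ b := by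
  obtain ⟨π, hπ⟩ := IsDiscreteValuationRing.exists_irreducible V
  have hπ0 : π ≠ 0 := hπ.ne_zero
  have hm : ∀ b : V, b ∈ IsLocalRing.maximalIdeal V ↔ π ∣ b := fun b => by
    rw [hπ.maximalIdeal_eq, Ideal.mem_span_singleton]
  -- `r b` is the residue of `b`, and `σ b = (b - r b) / π` is the shift of its expansion in the
  -- uniformizer `π`.
  choose r hr using hres
  simp only [hm] at hr
  choose σ hσ using hr
  have hσ' : ∀ b, b = algebraMap ℂ V (r b) + π * σ b := fun b => by rw [← hσ b]; ring
  have hr_unique : ∀ (b : V) (c : ℂ), π ∣ b - algebraMap ℂ V c → r b = c := by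
    intro b c hc
    by_contra hne
    have h1 : π ∣ algebraMap ℂ V (r b - c) := by
      have := dvd_sub hc ⟨σ b, hσ b⟩
      rwa [sub_sub_sub_cancel_left, ← map_sub] at this
    have h2 : IsUnit (algebraMap ℂ V (r b - c)) := (sub_ne_zero.2 hne).isUnit.map _
    exact hπ.not_isUnit (isUnit_of_dvd_unit h1 h2)
  have key : ∀ (b : V) (c : ℂ) (s : V), b = algebraMap ℂ V c + π * s → r b = c ∧ σ b = s := by
    intro b c s h
    have h1 : r b = c := hr_unique b c ⟨s, by rw [h]; ring⟩
    refine ⟨h1, mul_left_cancel₀ hπ0 ?_⟩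
    rw [← hσ b, h1, h]; ring
  have hadd : ∀ a b, r (a + b) = r a + r b ∧ σ (a + b) = σ a + σ b := fun a b =>
    key _ _ _ (by nth_rw 1 [hσ' a, hσ' b]; rw [map_add]; ring)
  have hsmul : ∀ (c : ℂ) b, r (algebraMap ℂ V c * b) = c * r b ∧
      σ (algebraMap ℂ V c * b) = algebraMap ℂ V c * σ b := fun c b =>
    key _ _ _ (by nth_rw 1 [hσ' b]; rw [map_mul]; ring)
  have hmul : ∀ a b, r (a * b) = r a * r b ∧
      σ (a * b) = algebraMap ℂ V (r a) * σ b + σ a * b := fun a b =>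
    key _ _ _ (by
      nth_rw 1 [hσ' a]; rw [map_mul, add_mul]; nth_rw 1 [hσ' b]; ring)
  have hconst : ∀ c : ℂ, r (algebraMap ℂ V c) = c ∧ σ (algebraMap ℂ V c) = 0 := fun c =>
    key _ _ _ (by ring)
  let φ₀ : V → ℂ⟦X⟧ := fun b => PowerSeries.mk fun n => r (σ^[n] b)
  have hφ₀ : ∀ b, φ₀ b = C (r b) + PowerSeries.X * φ₀ (σ b) := fun b => by
    ext n
    rcases n with _ | n
    · simp [φ₀]
    · simp [φ₀, coeff_succ_X_mul]
  have hφadd : ∀ a b, φ₀ (a + b) = φ₀ a + φ₀ b := by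
    intro a b
    have h1 : ∀ n, σ^[n] (a + b) = σ^[n] a + σ^[n] b := fun n => by
      induction n with
      | zero => rfl
      | succ n ih => rw [Function.iterate_succ_apply', ih, (hadd _ _).2,
          Function.iterate_succ_apply', Function.iterate_succ_apply']
    ext n
    simp [φ₀, h1, (hadd _ _).1]
  have hφsmul : ∀ (c : ℂ) b, φ₀ (algebraMap ℂ V c * b) = C c * φ₀ b := by
    intro c b
    have h1 : ∀ n, σ^[n] (algebraMap ℂ V c * b) = algebraMap ℂ V c * σ^[n] b := fun n => by
      induction n with
      | zero => rfl
      | succ n ih => rw [Function.iterate_succ_apply', ih, (hsmul _ _).2,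
          Function.iterate_succ_apply']
    ext n
    simp [φ₀, h1, (hsmul _ _).1]
  have hφconst : ∀ c : ℂ, φ₀ (algebraMap ℂ V c) = C c := fun c => by
    have h0 : φ₀ 0 = 0 := by simpa using hφadd 0 0
    rw [hφ₀, (hconst c).1, (hconst c).2, h0, mul_zero, add_zero]
  have hφmul : ∀ a b, φ₀ (a * b) = φ₀ a * φ₀ b := by
    -- The twisted Leibniz rule for `σ` reduces the multiplicativity defect of `(a, b)` to `X` times
    -- that of `(σ a, b)`, so it is divisible by every power of `X`.
    have h1 : ∀ (n : ℕ) a b, PowerSeries.X ^ n ∣ φ₀ (a * b) - φ₀ a * φ₀ b := by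
      intro n
      induction n with
      | zero => simp
      | succ n ih =>
        intro a b
        obtain ⟨e, he⟩ := ih (σ a) b
        refine ⟨e, ?_⟩
        rw [pow_succ', mul_assoc, ← he, hφ₀ (a * b), (hmul a b).1, (hmul a b).2, hφadd, hφsmul,
          hφ₀ a, mul_sub, map_mul]
        linear_combination -C (r a) * hφ₀ b
    intro a b
    rw [← sub_eq_zero]
    ext n
    rw [map_zero]
    exact X_pow_dvd_iff.1 (h1 (n + 1) a b) n n.lt_succ_self
  let φ : V →ₐ[ℂ] ℂ⟦X⟧ :=
    { toFun := φ₀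
      map_one' := by rw [← map_one (algebraMap ℂ V), hφconst, map_one]
      map_mul' := hφmul
      map_zero' := by rw [← map_zero (algebraMap ℂ V), hφconst, map_zero]
      map_add' := hφadd
      commutes' := hφconst }
  have hφπ : φ π = PowerSeries.X := by
    have h1 := key π 0 1 (by simp)
    change φ₀ π = PowerSeries.X
    rw [hφ₀, h1.1, h1.2, ← map_one (algebraMap ℂ V), hφconst]
    simp
  have hfact : ∀ a : V, a ≠ 0 → ∃ n u, IsUnit u ∧ a = π ^ n * u := fun a ha => by
    obtain ⟨n, u, h⟩ := IsDiscreteValuationRing.eq_unit_mul_pow_irreducible ha hπ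
    exact ⟨n, u, u.isUnit, by rw [h, mul_comm]⟩
  have hinj : Function.Injective φ := by
    rw [injective_iff_map_eq_zero]
    intro a ha
    by_contra ha0
    obtain ⟨n, u, hu, rfl⟩ := hfact a ha0
    rw [map_mul, map_pow, hφπ] at ha
    exact (mul_ne_zero (pow_ne_zero n PowerSeries.X_ne_zero) (hu.map φ).ne_zero) ha
  refine ⟨φ, hinj, fun a b hab => ?_⟩
  by_cases hb : b = 0
  · rw [hb]; exact dvd_zero a
  by_cases ha : a = 0
  · rw [ha, map_zero, zero_dvd_iff] at hab
    exact absurd (hinj (hab.trans (map_zero φ).symm)) hb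
  obtain ⟨n, u, hu, rfl⟩ := hfact a ha
  obtain ⟨m, v, hv, rfl⟩ := hfact b hb
  rw [map_mul, map_mul, map_pow, map_pow, hφπ, (hu.map φ).mul_right_dvd,
    (hv.map φ).dvd_mul_right, pow_dvd_pow_iff PowerSeries.X_ne_zero X_prime.not_isUnit] at hab
  rw [hu.mul_right_dvd, hv.dvd_mul_right]
  exact pow_dvd_pow π hab

end Expansion

/-! ### Normalization -/

attribute [local instance] FractionRing.liftAlgebra in
/-- Finiteness of the normalization of a domain that is finite over a Dedekind domain of
characteristic zero. -/
theorem exists_normalization (A D : Type*) [CommRing A] [IsDedekindDomain A] [CharZero A] [CommRing D]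
    [IsDomain D] [Algebra A D] [Module.Finite A D] [FaithfulSMul A D] :
    ∃ (B : Subalgebra D (FractionRing D)), IsDedekindDomain B ∧ Module.Finite D B ∧
      ∃ c : D, c ≠ 0 ∧ ∀ b : B, ∃ d : D, algebraMap D B c * b = algebraMap D B d := by
  have hfd : FiniteDimensional (FractionRing A) (FractionRing D) :=
    .of_isLocalization A D (nonZeroDivisors A)
  have : CharZero (FractionRing A) := charZero_of_injective_algebraMap
    (IsFractionRing.injective A (FractionRing A))
  -- Characteristic zero makes the extension of fraction fields separable, whence the integral
  -- closure is finite over `A`. It contains `D`, which is integral over `A`.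
  let B₀ := integralClosure A (FractionRing D)
  have hded : IsDedekindDomain B₀ := inferInstance
  have hfin : Module.Finite A B₀ :=
    IsIntegralClosure.finite A (FractionRing A) (FractionRing D) B₀
  have hD : ∀ d : D, algebraMap D (FractionRing D) d ∈ B₀ := fun d =>
    (Algebra.IsIntegral.isIntegral (R := A) d).algebraMap
  let B : Subalgebra D (FractionRing D) := { B₀.toSubsemiring with algebraMap_mem' := hD }
  have hdedB : IsDedekindDomain B := hded
  have hfinA : Module.Finite A B := hfin
  have hfinB : Module.Finite D B := Module.Finite.of_restrictScalars_finite A D B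
  refine ⟨B, hdedB, hfinB, ?_⟩
  classical
  obtain ⟨S, hS⟩ := hfinB.fg_top
  -- `c` is a common denominator of the generators of `B` over `D`, hence an element of the
  -- conductor.
  obtain ⟨c, hc⟩ := IsLocalization.exist_integer_multiples_of_finset (nonZeroDivisors D)
    (S.image (fun b : B => (b : FractionRing D)))
  refine ⟨c, nonZeroDivisors.coe_ne_zero c, fun b => ?_⟩
  have hb : b ∈ Submodule.span D (S : Set B) := hS ▸ Submodule.mem_top
  induction hb using Submodule.span_induction with
  | mem b hb =>
    obtain ⟨d, hd⟩ := hc (b : FractionRing D) (Finset.mem_image_of_mem _ hb)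
    refine ⟨d, Subtype.ext ?_⟩
    change algebraMap D (FractionRing D) c * (b : FractionRing D) = algebraMap D (FractionRing D) d
    rw [hd]
    exact (Algebra.smul_def _ _).symm
  | zero => exact ⟨0, by simp⟩
  | add x y _ _ hx hy =>
    obtain ⟨d, hd⟩ := hx
    obtain ⟨e, he⟩ := hy
    exact ⟨d + e, by rw [mul_add, hd, he, map_add]⟩
  | smul r x _ hx =>
    obtain ⟨d, hd⟩ := hx
    exact ⟨r * d, by rw [Algebra.smul_def, mul_left_comm, hd, map_mul]⟩

/-! ### Formal arcs -/

section Arcs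

open scoped PowerSeries

variable (φ : O₂ →ₐ[ℂ] ℂ⟦X⟧)

/-- Algebra maps into `ℂ⟦X⟧` are automatically local: otherwise the unit `w - c` would map to a
series without constant term. -/
theorem constantCoeff_arc (w : O₂) : PowerSeries.constantCoeff (φ w) = evalZero w := by
  set c := PowerSeries.constantCoeff (φ w) with hc
  by_contra hne
  have hu : IsUnit (w - algebraMap ℂ O₂ c) := by
    rw [isUnit_iff_evalZero, map_sub, evalZero_algebraMap]
    exact sub_ne_zero.2 (Ne.symm hne)
  have h1 := (hu.map φ).map (PowerSeries.constantCoeff (R := ℂ))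
  rw [map_sub, AlgHom.commutes, map_sub, ← hc] at h1
  simp at h1

theorem X_dvd_arc {w : O₂} (hw : w ∈ 𝔪) : PowerSeries.X ∣ φ w := by
  rw [PowerSeries.X_dvd_iff, constantCoeff_arc, mem_𝔪.1 hw]

/-- The chain rule along a formal arc. -/
theorem derivative_arc (w : O₂) : PowerSeries.derivative ℂ (φ w) =
    φ (dx w) * PowerSeries.derivative ℂ (φ X) + φ (dy w) * PowerSeries.derivative ℂ (φ Y) := by
  let δ : O₂ → ℂ⟦X⟧ := fun w => PowerSeries.derivative ℂ (φ w) -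
    (φ (dx w) * PowerSeries.derivative ℂ (φ X) + φ (dy w) * PowerSeries.derivative ℂ (φ Y))
  have hX : δ X = 0 := by
    simp [δ, dx_eq_dv, dy_eq_dv, dv_X]
  have hY : δ Y = 0 := by
    simp [δ, dx_eq_dv, dy_eq_dv, dv_Y]
  have hadd : ∀ a b, δ (a + b) = δ a + δ b := fun a b => by
    simp only [δ, dx_eq_dv, dy_eq_dv, dv_add, map_add]
    ring
  have hmul : ∀ a b, δ (a * b) = φ a * δ b + φ b * δ a := fun a b => by
    simp only [δ, dx_eq_dv, dy_eq_dv, dv_mul, map_add, map_mul, Derivation.leibniz, smul_eq_mul]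
    ring
  have hc : ∀ c : ℂ, δ (algebraMap ℂ O₂ c) = 0 := fun c => by
    simp only [δ, dx_eq_dv, dy_eq_dv, dv_algebraMap, map_zero, zero_mul, add_zero, sub_zero,
      AlgHom.commutes, Derivation.map_algebraMap]
  -- The defect `δ` is a derivation along `φ` that kills constants and coordinates; each use of
  -- `exists_hadamard` gains a factor `X`.
  have h1 : ∀ (k : ℕ) w, PowerSeries.X ^ k ∣ δ w := by
    intro k
    induction k with
    | zero => simp
    | succ k ih =>
      intro w
      obtain ⟨a, b, hab⟩ := exists_hadamard w
      rw [hab, hadd, hadd, hmul, hmul, hc, hX, hY, mul_zero, mul_zero, zero_add, zero_add, zero_add,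
        pow_succ']
      exact dvd_add (mul_dvd_mul (X_dvd_arc φ X_mem) (ih a))
        (mul_dvd_mul (X_dvd_arc φ Y_mem) (ih b))
  rw [← sub_eq_zero]
  ext n
  rw [map_zero]
  exact PowerSeries.X_pow_dvd_iff.1 (h1 (n + 1) w) n n.lt_succ_self

/-- The Euler derivative of a power series without constant term has the same order. -/
theorem associated_X_mul_derivative {a : ℂ⟦X⟧} (h : PowerSeries.X ∣ a) :
    Associated a (PowerSeries.X * PowerSeries.derivative ℂ a) := by
  by_cases ha : a = 0
  · simp [ha]
  obtain ⟨n, u, hu⟩ := IsDiscreteValuationRing.eq_unit_mul_pow_irreducible ha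
    PowerSeries.X_irreducible
  rcases n with _ | n
  · rw [hu, pow_zero, mul_one] at h
    exact absurd (isUnit_of_dvd_unit h u.isUnit) PowerSeries.X_prime.not_isUnit
  have h1 : PowerSeries.X * PowerSeries.derivative ℂ a =
      PowerSeries.X ^ (n + 1) * (((n + 1 : ℕ) : ℂ⟦X⟧) * (u : ℂ⟦X⟧) +
        PowerSeries.X * PowerSeries.derivative ℂ (u : ℂ⟦X⟧)) := by
    rw [hu, Derivation.leibniz, Derivation.leibniz_pow, PowerSeries.derivative_X]
    simp only [smul_eq_mul, nsmul_eq_mul, mul_one, Nat.add_sub_cancel]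
    ring
  have h2 : IsUnit (((n + 1 : ℕ) : ℂ⟦X⟧) * (u : ℂ⟦X⟧) +
      PowerSeries.X * PowerSeries.derivative ℂ (u : ℂ⟦X⟧)) := by
    rw [PowerSeries.isUnit_iff_constantCoeff, map_add, map_mul, map_mul,
      PowerSeries.constantCoeff_X, zero_mul, add_zero, map_natCast, isUnit_iff_ne_zero]
    exact mul_ne_zero (Nat.cast_ne_zero.2 n.succ_ne_zero)
      (u.isUnit.map (PowerSeries.constantCoeff (R := ℂ))).ne_zero
  have h3 : Associated (PowerSeries.X ^ (n + 1)) a := ⟨u, by rw [mul_comm, ← hu]⟩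
  rw [h1]
  exact h3.symm.trans ⟨h2.unit, rfl⟩

/-- Along an arc in a component of the polar curve `f_y = 0`, the germs `f` and `x f_x` have the
same order. -/
theorem arc_associated {f : O₂} (hf : f ∈ 𝔪) (hy : φ (dy f) = 0) :
    Associated (φ f) (φ (X * dx f)) := by
  have h1 := derivative_arc φ f
  rw [hy, zero_mul, add_zero] at h1
  -- Along the arc `f` has the order of `t f' = f_x · t x'`, and `t x'` has the order of `x`.
  refine (associated_X_mul_derivative (X_dvd_arc φ hf)).trans ?_
  rw [h1, map_mul, mul_left_comm, mul_comm (φ X)]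
  exact ((associated_X_mul_derivative (X_dvd_arc φ X_mem)).symm).mul_left _

end Arcs

/-! ### Comparison of colengths in a ring and its normalization -/

section Colength

theorem finrank_quotient_range_comp {A B E : Type*} [AddCommGroup A] [Module ℂ A]
    [AddCommGroup B] [Module ℂ B] [AddCommGroup E] [Module ℂ E] (α : A →ₗ[ℂ] B) (β : E →ₗ[ℂ] A)
    (hα : Function.Injective α) [Module.Finite ℂ (A ⧸ LinearMap.range β)]
    [Module.Finite ℂ (B ⧸ LinearMap.range α)] :
    Module.Finite ℂ (B ⧸ LinearMap.range (α ∘ₗ β)) ∧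
    Module.finrank ℂ (B ⧸ LinearMap.range (α ∘ₗ β)) =
      Module.finrank ℂ (A ⧸ LinearMap.range β) + Module.finrank ℂ (B ⧸ LinearMap.range α) := by
  have hle : LinearMap.range β ≤ (LinearMap.range (α ∘ₗ β)).comap α := by
    rintro _ ⟨e, rfl⟩
    exact ⟨e, rfl⟩
  have hle2 : LinearMap.range (α ∘ₗ β) ≤ LinearMap.range α := LinearMap.range_comp_le_range _ _
  refine finite_and_finrank_of_exact (Submodule.mapQ _ _ α hle) (Submodule.factor hle2) ?_
    (Submodule.factor_surjective hle2) ?_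
  · refine (injective_iff_map_eq_zero _).2 fun a ha => ?_
    obtain ⟨a, rfl⟩ := Submodule.Quotient.mk_surjective _ a
    rw [Submodule.mapQ_apply, Submodule.Quotient.mk_eq_zero] at ha
    obtain ⟨e, he⟩ := ha
    exact (Submodule.Quotient.mk_eq_zero _).2 ⟨e, hα he⟩
  · intro b
    obtain ⟨b, rfl⟩ := Submodule.Quotient.mk_surjective _ b
    rw [← Submodule.mkQ_apply, Submodule.factor_mk, Submodule.mkQ_apply,
      Submodule.Quotient.mk_eq_zero]
    constructor
    · rintro ⟨a, rfl⟩
      exact ⟨Submodule.Quotient.mk a, rfl⟩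
    · rintro ⟨a, ha⟩
      obtain ⟨a, rfl⟩ := Submodule.Quotient.mk_surjective _ a
      rw [Submodule.mapQ_apply, Submodule.mkQ_apply, Submodule.Quotient.eq] at ha
      have h1 := sub_mem (LinearMap.mem_range_self α a) (hle2 ha)
      rwa [sub_sub_cancel] at h1

/-- The quotient by a principal ideal as the cokernel of a multiplication map. -/
def quotientSpanEquiv {D : Type*} [CommRing D] [Algebra ℂ D] (a : D) :
    (D ⧸ LinearMap.range (LinearMap.mulLeft ℂ a)) ≃ₗ[ℂ] D ⧸ Ideal.span {a} :=
  (Submodule.quotEquivOfEq _ _ (by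
    ext x
    simp only [LinearMap.mem_range, LinearMap.mulLeft_apply, Submodule.restrictScalars_mem,
      Ideal.mem_span_singleton]
    exact ⟨fun ⟨y, h⟩ => ⟨y, h.symm⟩, fun ⟨y, h⟩ => ⟨y, h.symm⟩⟩)).trans
    (Submodule.Quotient.restrictScalarsEquiv ℂ (Ideal.span {a}))

variable {D B : Type*} [CommRing D] [CommRing B] [Algebra ℂ D]
  [Algebra ℂ B] [Algebra D B] [IsScalarTower ℂ D B]

/-- As `c B ⊆ D`, the quotient `B / D` is the image of finitely many copies of `D / c D`, one for
each generator of `B`. -/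
theorem finite_conductor_quotient [Module.Finite D B]
    {c : D} [Module.Finite ℂ (D ⧸ Ideal.span {c})]
    (hc : ∀ b : B, ∃ d : D, algebraMap D B c * b = algebraMap D B d) :
    Module.Finite ℂ (B ⧸ LinearMap.range (IsScalarTower.toAlgHom ℂ D B).toLinearMap) := by
  obtain ⟨S, hS⟩ := Module.Finite.fg_top (R := D) (M := B)
  let j := (IsScalarTower.toAlgHom ℂ D B).toLinearMap
  let q := (LinearMap.range j).mkQ
  let G : (S → D ⧸ LinearMap.range (LinearMap.mulLeft ℂ c)) →ₗ[ℂ] B ⧸ LinearMap.range j :=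
    ∑ s : S, ((LinearMap.range (LinearMap.mulLeft ℂ c)).liftQ
      (q ∘ₗ (LinearMap.mulRight ℂ (s : B)) ∘ₗ j) (by
        rintro _ ⟨d, rfl⟩
        obtain ⟨e, he⟩ := hc (algebraMap D B d * s)
        refine (Submodule.Quotient.mk_eq_zero _).2 ⟨e, ?_⟩
        change algebraMap D B e = algebraMap D B (c * d) * s
        rw [← he, map_mul]; ring)) ∘ₗ LinearMap.proj s
  have : Module.Finite ℂ (D ⧸ LinearMap.range (LinearMap.mulLeft ℂ c)) :=
    Module.Finite.equiv (quotientSpanEquiv c).symm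
  refine Module.Finite.of_surjective G fun b => ?_
  obtain ⟨b, rfl⟩ := Submodule.Quotient.mk_surjective _ b
  have hb : b ∈ Submodule.span D (S : Set B) := hS ▸ Submodule.mem_top
  obtain ⟨f, hf⟩ := (Submodule.mem_span_finset'.1 hb)
  refine ⟨fun s => Submodule.Quotient.mk (f s), ?_⟩
  rw [← hf]
  change _ = q _
  rw [map_sum, LinearMap.sum_apply]
  refine Finset.sum_congr rfl fun s _ => ?_
  rw [Algebra.smul_def]
  rfl

/-- The colength of a principal ideal does not change when passing to a finite birational
extension. -/
theorem colength_extension [IsDomain B] (hinj : Function.Injective (algebraMap D B))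
    [Module.Finite ℂ (B ⧸ LinearMap.range (IsScalarTower.toAlgHom ℂ D B).toLinearMap)]
    {a : D} (ha : a ≠ 0) [Module.Finite ℂ (D ⧸ Ideal.span {a})] :
    Module.finrank ℂ (D ⧸ Ideal.span {a}) =
      Module.finrank ℂ (B ⧸ Ideal.span {algebraMap D B a}) := by
  let j := (IsScalarTower.toAlgHom ℂ D B).toLinearMap
  let aD := LinearMap.mulLeft ℂ a
  let aB := LinearMap.mulLeft ℂ (algebraMap D B a)
  have hcomm : j ∘ₗ aD = aB ∘ₗ j := by
    ext d
    exact map_mul (algebraMap D B) a d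
  have haB : Function.Injective aB := fun x y h =>
    mul_left_cancel₀ ((map_ne_zero_iff _ hinj).2 ha) h
  have hfin : Module.Finite ℂ (D ⧸ LinearMap.range aD) :=
    Module.Finite.equiv (quotientSpanEquiv a).symm
  have h1 := finrank_quotient_range_comp j aD hinj
  have hfin2 : Module.Finite ℂ (B ⧸ LinearMap.range aB) := by
    have := h1.1
    have hle : LinearMap.range (j ∘ₗ aD) ≤ LinearMap.range aB := by
      rw [hcomm]; exact LinearMap.range_comp_le_range _ _
    exact Module.Finite.of_surjective _ (Submodule.factor_surjective hle)
  have h2 := finrank_quotient_range_comp aB j haB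
  rw [← (quotientSpanEquiv a).finrank_eq, ← (quotientSpanEquiv (algebraMap D B a)).finrank_eq]
  -- The codimension of `a D` in `B` is counted through `D` and through `a B`. Multiplication by `a`
  -- identifies `B / D` with `a B / a D`, so the common summand cancels.
  have h3 := h1.2
  rw [hcomm, h2.2] at h3
  change Module.finrank ℂ (D ⧸ LinearMap.range aD) = Module.finrank ℂ (B ⧸ LinearMap.range aB)
  omega

end Colength

/-! ### Residue fields of the normalization -/

section Residue

theorem mem_of_eval_eq_zero {D B : Type*} [CommRing D] [IsLocalRing D] [CommRing B]
    [Algebra ℂ D] [Algebra D B] [Algebra.IsIntegral D B] (ε : D →ₐ[ℂ] ℂ) (P : Ideal B) [P.IsMaximal] {d : D} (hd : ε d = 0) :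
    algebraMap D B d ∈ P := by
  have h1 := Ideal.isMaximal_comap_of_isIntegral_of_isMaximal (R := D) P
  rw [← Ideal.mem_comap, IsLocalRing.eq_maximalIdeal h1, IsLocalRing.mem_maximalIdeal,
    mem_nonunits_iff]
  exact fun hu => (hu.map ε).ne_zero hd

variable {D B : Type*} [CommRing D] [IsLocalRing D] [CommRing B] [Algebra ℂ D]
  [Algebra ℂ B] [Algebra D B] [IsScalarTower ℂ D B] [Algebra.IsIntegral D B]

/-- `B` is integral over `D`, and `P` contracts to the maximal ideal of `D`, whose residue field is
`ℂ`. So `B / P` is integral over the algebraically closed field `ℂ`. -/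
theorem exists_residue (ε : D →ₐ[ℂ] ℂ) (P : Ideal B) [P.IsMaximal] (x : B) :
    ∃ c : ℂ, x - algebraMap ℂ B c ∈ P := by
  have hint : ((algebraMap ℂ (B ⧸ P)).comp (ε : D →+* ℂ)).IsIntegral := by
    have h1 : (algebraMap ℂ (B ⧸ P)).comp (ε : D →+* ℂ) =
        (Ideal.Quotient.mk P).comp (algebraMap D B) := by
      ext d
      refine (Ideal.Quotient.eq.2 (?_ : algebraMap ℂ B (ε d) - algebraMap D B d ∈ P))
      rw [IsScalarTower.algebraMap_apply ℂ D B, ← map_sub]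
      exact mem_of_eval_eq_zero ε P (by simp)
    rw [h1]
    refine RingHom.IsIntegral.trans _ _ (algebraMap_isIntegral_iff.2 inferInstance) ?_
    exact RingHom.isIntegral_of_surjective _ Ideal.Quotient.mk_surjective
  have h2 : (algebraMap ℂ (B ⧸ P)).IsIntegral := RingHom.IsIntegral.tower_top _ _ hint
  have : Algebra.IsIntegral ℂ (B ⧸ P) := algebraMap_isIntegral_iff.1 h2
  have : IsDomain (B ⧸ P) := Ideal.Quotient.isDomain P
  obtain ⟨c, hc⟩ := (IsAlgClosed.algebraMap_bijective_of_isIntegral (k := ℂ) (K := B ⧸ P)).2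
    (Ideal.Quotient.mk P x)
  exact ⟨c, Ideal.Quotient.eq.1 hc.symm⟩

theorem exists_residue_localization {P : Ideal B} [P.IsMaximal]
    (hP : ∀ x : B, ∃ c : ℂ, x - algebraMap ℂ B c ∈ P) (v : Localization.AtPrime P) :
    ∃ c : ℂ, v - algebraMap ℂ (Localization.AtPrime P) c ∈
      IsLocalRing.maximalIdeal (Localization.AtPrime P) := by
  obtain ⟨b, s, rfl⟩ := IsLocalization.exists_mk'_eq P.primeCompl v
  obtain ⟨cb, hb⟩ := hP b
  obtain ⟨cs, hs⟩ := hP s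
  have hcs : cs ≠ 0 := by
    rintro rfl
    rw [map_zero, sub_zero] at hs
    exact s.2 hs
  refine ⟨cb / cs, ?_⟩
  have hsu : IsUnit (algebraMap B (Localization.AtPrime P) s) := IsLocalization.map_units _ s
  rw [← Ideal.unit_mul_mem_iff_mem _ hsu, mul_sub, IsLocalization.mk'_spec',
    IsScalarTower.algebraMap_apply ℂ B (Localization.AtPrime P), ← map_mul, ← map_sub,
    IsLocalization.AtPrime.to_map_mem_maximal_iff _ P]
  have h1 : b - s * algebraMap ℂ B (cb / cs) =
      (b - algebraMap ℂ B cb) - (s - algebraMap ℂ B cs) * algebraMap ℂ B (cb / cs) := by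
    have : algebraMap ℂ B cs * algebraMap ℂ B (cb / cs) = algebraMap ℂ B cb := by
      rw [← map_mul, mul_div_cancel₀ _ hcs]
    linear_combination -this
  rw [h1]
  exact sub_mem hb (Ideal.mul_mem_right _ _ hs)

end Residue

/-- If two elements of a one-dimensional local domain have the same order along all formal arcs and
one of them is not zero, then so is the other, and they have the same colength. -/
theorem finrank_eq_of_arcs (A : Type*) {D : Type*} [CommRing A] [IsDedekindDomain A] [CharZero A]
    [CommRing D] [IsDomain D] [IsLocalRing D] [Algebra ℂ D] [Algebra A D] [Module.Finite A D]
    [FaithfulSMul A D] (ε : D →ₐ[ℂ] ℂ) (hε : ∃ x, ε x = 0 ∧ x ≠ 0)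
    (hfin : ∀ a : D, a ≠ 0 → Module.Finite ℂ (D ⧸ Ideal.span {a})) {a b : D} (ha : a ≠ 0)
    (h : ∀ ψ : D →ₐ[ℂ] PowerSeries ℂ, Associated (ψ a) (ψ b)) :
    b ≠ 0 ∧ Module.finrank ℂ (D ⧸ Ideal.span {a}) = Module.finrank ℂ (D ⧸ Ideal.span {b}) := by
  obtain ⟨B, hB, hBfin, c, hc0, hc⟩ := exists_normalization A D
  have hDB : Function.Injective (algebraMap D B) := fun x y h =>
    IsFractionRing.injective D (FractionRing D) (congrArg Subtype.val h)
  have := hfin c hc0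
  have := hfin a ha
  have hBD := finite_conductor_quotient (B := B) hc
  -- The nonzero element `x` of the maximal ideal of `D` lies in every `P`; thus the localizations
  -- are discrete valuation rings and not fields.
  have hbot : ∀ P : Ideal B, P.IsMaximal → P ≠ ⊥ := by
    rintro P hP rfl
    obtain ⟨x, hx, hx0⟩ := hε
    have h1 := mem_of_eval_eq_zero ε (⊥ : Ideal B) hx
    rw [Ideal.mem_bot, map_eq_zero_iff _ hDB] at h1
    exact hx0 h1
  have hexp : ∀ (P : Ideal B) (_ : P.IsMaximal), ∃ ψ : D →ₐ[ℂ] PowerSeries ℂ,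
      Function.Injective ψ ∧ ∀ x y, ψ x ∣ ψ y →
        algebraMap B (Localization.AtPrime P) (algebraMap D B x) ∣
          algebraMap B (Localization.AtPrime P) (algebraMap D B y) := by
    intro P hP
    have hdvr : IsDiscreteValuationRing (Localization.AtPrime P) :=
      IsLocalization.AtPrime.isDiscreteValuationRing_of_dedekind_domain B (hbot P hP) _
    -- Each point `P` of the normalization gives the arc `D → B → B_P → ℂ⟦t⟧`, which detects
    -- divisibility in `B_P`.
    obtain ⟨φ, hφ', hφ⟩ := exists_expansion (exists_residue_localization (exists_residue ε P))
    refine ⟨(φ.comp (IsScalarTower.toAlgHom ℂ B (Localization.AtPrime P))).comp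
        (IsScalarTower.toAlgHom ℂ D B), ?_, fun x y => hφ _ _⟩
    exact (hφ'.comp (IsLocalization.injective _ P.primeCompl_le_nonZeroDivisors)).comp hDB
  have hb : b ≠ 0 := by
    rintro rfl
    obtain ⟨P, hP⟩ := Ideal.exists_maximal B
    obtain ⟨ψ, hψ, -⟩ := hexp P hP
    have h1 := h ψ
    rw [map_zero, associated_zero_iff_eq_zero, map_eq_zero_iff _ hψ] at h1
    exact ha h1
  have := hfin b hb
  -- The two principal ideals agree in every `B_P`, hence in `B`, where the colengths are compared.
  have hspan : Ideal.span {algebraMap D B a} = Ideal.span {algebraMap D B b} := by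
    refine Ideal.eq_of_localization_maximal fun P hP => ?_
    rw [Ideal.map_span, Ideal.map_span, Set.image_singleton, Set.image_singleton,
      Ideal.span_singleton_eq_span_singleton]
    obtain ⟨ψ, -, hψ⟩ := hexp P hP
    exact associated_of_dvd_dvd (hψ _ _ (h ψ).dvd) (hψ _ _ (h ψ).symm.dvd)
  refine ⟨hb, ?_⟩
  rw [colength_extension (B := B) hDB ha, colength_extension (B := B) hDB hb, hspan]

/-! ### Branches of the polar curve -/

section Branch

variable {q : O₂}

/-- The local ring of the curve `q = 0`. -/
abbrev CurveRing (q : O₂) : Type := O₂ ⧸ Ideal.span {q}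

/-- Evaluation at the origin on the ring of a curve germ. -/
def evalQuotient (hq : q ∈ 𝔪) : (O₂ ⧸ Ideal.span {q}) →ₐ[ℂ] ℂ :=
  Ideal.Quotient.liftₐ (Ideal.span {q})
    { evalZero with commutes' := evalZero_algebraMap } fun a ha => by
      obtain ⟨b, rfl⟩ := Ideal.mem_span_singleton.1 ha
      exact (map_mul evalZero q b).trans (by rw [mem_𝔪.1 hq, zero_mul])

theorem colength_quotient (q b : O₂) :
    Nonempty (((O₂ ⧸ Ideal.span {q}) ⧸ Ideal.span {Ideal.Quotient.mk (Ideal.span {q}) b}) ≃ₗ[ℂ]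
      O₂ ⧸ Ideal.span {q, b}) := by
  have h1 : Ideal.span {Ideal.Quotient.mk (Ideal.span {q}) b} =
      (Ideal.span {b}).map (Ideal.Quotient.mkₐ ℂ (Ideal.span {q})) := by
    rw [Ideal.map_span, Set.image_singleton]; rfl
  have h2 : Ideal.span {q, b} = Ideal.span {q} ⊔ Ideal.span {b} := Ideal.span_insert _ _
  rw [h1, h2]
  exact ⟨(DoubleQuot.quotQuotEquivQuotSupₐ ℂ (Ideal.span {q}) (Ideal.span {b})).toLinearEquiv⟩

theorem finite_of_prime {q b : O₂} {d : ℕ} (hq : Prime q) (hr : YRegular q d) (hb : ¬ q ∣ b) :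
    Module.Finite ℂ (O₂ ⧸ Ideal.span {q, b}) :=
  finite_of_coprime hr fun _ hp hpq hpb => hb (((hp.associated_of_dvd hq hpq).symm.dvd).trans hpb)

/-- The ring of the branch is finite over `O₁` through `x`, and `O₁` embeds in it because `q`
divides no power of `X`. So `finrank_eq_of_arcs` applies, with `arc_associated` supplying the
orders. -/
theorem finrank_eq_of_branch {d : ℕ} (hq : Prime q) (hr : YRegular q d) {f : O₂} (hf : f ∈ 𝔪)
    (hy : q ∣ dy f) (hqf : ¬ q ∣ f) :
    ¬ q ∣ X * dx f ∧ Module.finrank ℂ (O₂ ⧸ Ideal.span {q, f}) =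
      Module.finrank ℂ (O₂ ⧸ Ideal.span {q, X * dx f}) := by
  have hqm : q ∈ 𝔪 := by
    by_contra h
    exact hq.not_isUnit (isUnit_iff_notMem.2 h)
  have hprime : (Ideal.span {q}).IsPrime := (Ideal.span_singleton_prime hq.ne_zero).2 hq
  have hdom : IsDomain (CurveRing q) := Ideal.Quotient.isDomain _
  have hloc : IsLocalRing (CurveRing q) := IsLocalRing.of_surjective' (Ideal.Quotient.mk (Ideal.span {q}))
    Ideal.Quotient.mk_surjective
  have hfin : Module.Finite O₁ (CurveRing q) := hr.finite
  have hinj : FaithfulSMul O₁ (CurveRing q) := by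
    refine (faithfulSMul_iff_algebraMap_injective O₁ (CurveRing q)).2 ?_
    rw [injective_iff_map_eq_zero]
    intro a ha
    by_contra ha0
    obtain ⟨n, u, hu, rfl⟩ := exists_eq_T_pow_mul a ha0
    have h1 : liftX (T ^ n * u) ∈ Ideal.span {q} := Ideal.Quotient.eq_zero_iff_mem.1 ha
    rw [map_mul, map_pow, liftX_T, Ideal.mul_unit_mem_iff_mem _ (hu.map liftX),
      Ideal.mem_span_singleton] at h1
    exact not_dvd_X_pow hr hqm n h1
  have hchar : CharZero O₁ := charZero_of_injective_algebraMap (algebraMap ℂ O₁).injective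
  let π : O₂ →ₐ[ℂ] CurveRing q := Ideal.Quotient.mkₐ ℂ (Ideal.span {q})
  have hπ : ∀ a, π a = 0 ↔ q ∣ a := fun a =>
    Ideal.Quotient.eq_zero_iff_mem.trans Ideal.mem_span_singleton
  have hnz : ∀ a : CurveRing q, a ≠ 0 → Module.Finite ℂ (CurveRing q ⧸ Ideal.span {a}) := by
    intro a ha
    obtain ⟨a, rfl⟩ := Ideal.Quotient.mk_surjective a
    obtain ⟨e⟩ := colength_quotient q a
    have := finite_of_prime hq hr (fun h => ha ((hπ a).2 h))
    exact Module.Finite.equiv e.symm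
  have h := finrank_eq_of_arcs O₁ (evalQuotient hqm) (a := π f) (b := π (X * dx f))
    ⟨π X, rfl, fun h => not_dvd_X_pow hr hqm 1 (by rw [pow_one]; exact (hπ X).1 h)⟩ hnz
    (fun h => hqf ((hπ f).1 h))
    (fun ψ => arc_associated (ψ.comp π) hf (by rw [AlgHom.comp_apply, (hπ _).2 hy, map_zero]))
  obtain ⟨e1⟩ := colength_quotient q f
  obtain ⟨e2⟩ := colength_quotient q (X * dx f)
  rw [← e1.finrank_eq, ← e2.finrank_eq]
  exact ⟨fun hd => h.1 ((hπ _).2 hd), h.2⟩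

end Branch

/-! ### The case without base points -/

/-- If `f = q k` and `q ∣ f_y`, then `q ∣ k q_y`. Square-freeness excludes `q ∣ k`, and `q ∣ q_y`
fails because differentiation lowers the order on the `y`-axis by one. -/
theorem not_dvd_of_squarefree {f : O₂} {n : ℕ} (hr : YRegular f n) (hf : Squarefree f) {q : O₂}
    (hq : Prime q) (hqy : q ∣ dy f) : ¬ q ∣ f := by
  rintro ⟨k, rfl⟩
  obtain ⟨a, ha⟩ := hr.of_dvd (Dvd.intro _ rfl)
  rcases a with _ | a
  · exact hq.not_isUnit (ha.isUnit_iff.2 rfl)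
  have h1 : q ∣ k * dy q := by
    rw [dy_eq_dv, dv_mul] at hqy
    exact (dvd_add_right (Dvd.intro _ rfl)).1 hqy
  rcases hq.dvd_or_dvd h1 with h2 | ⟨e, he⟩
  · exact hq.not_isUnit (hf q (mul_dvd_mul_left q h2))
  · have h3 := ha.dy
    rw [he] at h3
    obtain ⟨b, hb⟩ := h3.of_dvd (Dvd.intro_left _ rfl)
    have := h3.unique (ha.mul hb)
    omega

theorem colength_X_mul {q g : O₂} {d : ℕ} (hq : Prime q) (hr : YRegular q d) (hg : ¬ q ∣ g) :
    Module.finrank ℂ (O₂ ⧸ Ideal.span {q, X * g}) =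
      Module.finrank ℂ (O₂ ⧸ Ideal.span {q, g}) + Module.finrank ℂ (O₂ ⧸ Ideal.span {q, X}) := by
  have hX : ¬ q ∣ X := by
    have hqm : q ∈ 𝔪 := by
      by_contra h
      exact hq.not_isUnit (isUnit_iff_notMem.2 h)
    simpa using not_dvd_X_pow hr hqm 1
  have := finite_of_prime hq hr hg
  have := finite_of_prime hq hr hX
  rw [Set.pair_comm q, Set.pair_comm q, Set.pair_comm q] at *
  refine (colength_mul X_ne_zero fun c ⟨e, he⟩ => ?_).2
  obtain ⟨e', rfl⟩ := (hq.dvd_or_dvd (Dvd.intro _ he)).resolve_left hX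
  exact ⟨e', mul_left_cancel₀ hq.ne_zero (by linear_combination he)⟩

/-- Each prime factor `q` of `g` satisfies `i(q, f) = i(q, f_x) + i(q, x)`. Colengths add over prime
factors, with multiplicity, and `i(g, x) = d`. -/
theorem colength_polar {f g : O₂} {d : ℕ} (hf : f ∈ 𝔪) (hr : YRegular g d) (hg : g ∣ dy f)
    (hgf : ∀ q, Prime q → q ∣ g → ¬ q ∣ f) :
    (∀ q, Prime q → q ∣ g → ¬ q ∣ dx f) ∧ Module.finrank ℂ (O₂ ⧸ Ideal.span {g, f}) =
      Module.finrank ℂ (O₂ ⧸ Ideal.span {g, dx f}) + d := by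
  have hbranch : ∀ q, Prime q → q ∣ g → ∃ e, YRegular q e ∧ ¬ q ∣ dx f ∧ ¬ q ∣ X ∧
      Module.finrank ℂ (O₂ ⧸ Ideal.span {q, f}) = Module.finrank ℂ (O₂ ⧸ Ideal.span {q, dx f}) +
        Module.finrank ℂ (O₂ ⧸ Ideal.span {q, X}) := by
    intro q hq hqg
    obtain ⟨e, he⟩ := hr.of_dvd hqg
    obtain ⟨h1, h2⟩ := finrank_eq_of_branch hq he hf (hqg.trans hg) (hgf q hq hqg)
    have h3 : ¬ q ∣ dx f := fun h => h1 (h.mul_left X)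
    exact ⟨e, he, h3, fun h => h1 (h.mul_right _), h2.trans (colength_X_mul hq he h3)⟩
  have hgx : ∀ q, Prime q → q ∣ g → ¬ q ∣ dx f := fun q hq hqg =>
    (hbranch q hq hqg).choose_spec.2.1
  refine ⟨hgx, ?_⟩
  -- Divisors of `g` need not divide off as derivatives of `f`; the induction on prime factors
  -- therefore runs over all divisors `c`.
  suffices h : ∀ c, c ∣ g → Module.finrank ℂ (O₂ ⧸ Ideal.span {c, f}) =
      Module.finrank ℂ (O₂ ⧸ Ideal.span {c, dx f}) + Module.finrank ℂ (O₂ ⧸ Ideal.span {c, X}) by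
    rw [h g dvd_rfl, (colength_X hr).2]
  intro c hcg
  obtain ⟨e, he⟩ := hr.of_dvd hcg
  revert hcg
  refine YRegular.induction (P := fun c => c ∣ g → Module.finrank ℂ (O₂ ⧸ Ideal.span {c, f}) =
      Module.finrank ℂ (O₂ ⧸ Ideal.span {c, dx f}) + Module.finrank ℂ (O₂ ⧸ Ideal.span {c, X}))
    ?_ ?_ he
  · intro u hu _
    have h1 : ∀ b, Module.finrank ℂ (O₂ ⧸ Ideal.span {u, b}) = 0 := fun b => by
      have : Subsingleton (O₂ ⧸ Ideal.span {u, b}) := Ideal.Quotient.subsingleton_iff.2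
        (Ideal.eq_top_of_isUnit_mem _ (Ideal.subset_span (by simp)) hu)
      exact Module.finrank_zero_of_subsingleton
    rw [h1, h1, h1]
  · intro q c hq ih hqc
    obtain ⟨e, he, hqx, hqX, hdim⟩ := hbranch q hq ((Dvd.intro _ rfl).trans hqc)
    have hqf := hgf q hq ((Dvd.intro _ rfl).trans hqc)
    have hcg : c ∣ g := (Dvd.intro_left _ rfl).trans hqc
    obtain ⟨e', he'⟩ := hr.of_dvd hcg
    have hmul : ∀ b, ¬ q ∣ b → (∀ p, Prime p → p ∣ c → ¬ p ∣ b) →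
        Module.finrank ℂ (O₂ ⧸ Ideal.span {q * c, b}) =
          Module.finrank ℂ (O₂ ⧸ Ideal.span {c, b}) + Module.finrank ℂ (O₂ ⧸ Ideal.span {q, b}) := by
      intro b hqb hcb
      have := finite_of_prime hq he hqb
      have := finite_of_coprime he' hcb
      exact (colength_mul hq.ne_zero fun a ha => (hq.dvd_or_dvd ha).resolve_left hqb).2
    rw [hmul f hqf fun p hp hpc => hgf p hp (hpc.trans hcg),
      hmul _ hqx fun p hp hpc => hgx p hp (hpc.trans hcg),
      hmul _ hqX fun p hp hpc => (hbranch p hp (hpc.trans hcg)).choose_spec.2.2.1, ih hcg, hdim]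
    ring

/-! ### Twisting by powers of the maximal ideal -/

/-- The colength of `(g, b) J`, for a regular sequence `g, b` and ideals `J` and `L = J : g` with
`b L ⊆ J`. -/
theorem colength_span_pair_mul {K R : Type*} [Field K] [CommRing R] [IsDomain R] [Algebra K R]
    {g b : R} {J L : Ideal R} (hg0 : g ≠ 0) (hgL : ∀ a, g * a ∈ J ↔ a ∈ L)
    (hbL : ∀ a ∈ L, b * a ∈ J) (hgb : ∀ c, g ∣ b * c → g ∣ c)
    [Module.Finite K (R ⧸ Ideal.span {g, b})] [Module.Finite K (R ⧸ J)]
    [Module.Finite K (R ⧸ L)] :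
    Module.Finite K (R ⧸ Ideal.span {g, b} * J) ∧
      Module.finrank K (R ⧸ Ideal.span {g, b} * J) + Module.finrank K (R ⧸ L) =
        Module.finrank K (R ⧸ Ideal.span {g, b}) + 2 * Module.finrank K (R ⧸ J) := by
  set I := Ideal.span {g, b} with hI
  have hgI : g ∈ I := Ideal.subset_span (by simp)
  have hbI : b ∈ I := Ideal.subset_span (by simp)
  have hle : I * J ≤ I := Ideal.mul_le_left
  let mg : (R ⧸ J) →ₗ[R] R ⧸ I * J := Submodule.mapQ J (I * J) (LinearMap.mulLeft R g)
    fun a ha => Ideal.mul_mem_mul hgI ha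
  let mb : (R ⧸ J) →ₗ[R] R ⧸ I * J := Submodule.mapQ J (I * J) (LinearMap.mulLeft R b)
    fun a ha => Ideal.mul_mem_mul hbI ha
  let α : ((R ⧸ J) × (R ⧸ J)) →ₗ[R] R ⧸ I * J := mg.coprod mb
  have hα : ∀ u v, α (Submodule.Quotient.mk u, Submodule.Quotient.mk v) =
      Submodule.Quotient.mk (g * u + b * v) := fun u v => rfl
  let ng : (R ⧸ L) →ₗ[R] R ⧸ J := Submodule.mapQ L J (LinearMap.mulLeft R g)
    fun a ha => (hgL a).2 ha
  let nb : (R ⧸ L) →ₗ[R] R ⧸ J := Submodule.mapQ L J (LinearMap.mulLeft R b) hbL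
  -- The count comes from `0 → R/L → (R/J)² → R/IJ → R/I → 0`, with the Koszul maps `w ↦ (-bw, gw)`
  -- and `(u, v) ↦ gu + bv`.
  let β : (R ⧸ L) →ₗ[R] (R ⧸ J) × (R ⧸ J) := (-nb).prod ng
  have hβ : ∀ w, β (Submodule.Quotient.mk w) =
      (Submodule.Quotient.mk (-(b * w)), Submodule.Quotient.mk (g * w)) := fun w => rfl
  have hβinj : Function.Injective β := by
    refine (injective_iff_map_eq_zero _).2 fun a ha => ?_
    obtain ⟨w, rfl⟩ := Submodule.Quotient.mk_surjective _ a
    rw [hβ, Prod.mk_eq_zero, Submodule.Quotient.mk_eq_zero, Submodule.Quotient.mk_eq_zero] at ha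
    exact (Submodule.Quotient.mk_eq_zero _).2 ((hgL w).1 ha.2)
  have hker : ∀ u v, g * u + b * v ∈ I * J ↔ (Submodule.Quotient.mk u, Submodule.Quotient.mk v) ∈
      Set.range β := by
    intro u v
    constructor
    · intro h
      rw [hI, Ideal.span_insert, Ideal.sup_mul, Submodule.mem_sup] at h
      obtain ⟨y, hy, z, hz, hyz⟩ := h
      obtain ⟨s, hs, rfl⟩ := Ideal.mem_span_singleton_mul.1 hy
      obtain ⟨t, ht, rfl⟩ := Ideal.mem_span_singleton_mul.1 hz
      obtain ⟨e, he⟩ := hgb (v - t) ⟨s - u, by linear_combination -hyz⟩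
      have he2 : u - s = -(b * e) := mul_left_cancel₀ hg0 (by linear_combination -hyz - b * he)
      refine ⟨Submodule.Quotient.mk e, ?_⟩
      rw [hβ]
      refine Prod.ext ((Submodule.Quotient.eq _).2 ?_) ((Submodule.Quotient.eq _).2 ?_)
      · rw [← he2, sub_sub_cancel_left]
        exact neg_mem hs
      · rw [← he, sub_sub_cancel_left]
        exact neg_mem ht
    · rintro ⟨w, hw⟩
      obtain ⟨w, rfl⟩ := Submodule.Quotient.mk_surjective _ w
      rw [hβ] at hw
      have h1 := (Submodule.Quotient.eq _).1 (congrArg Prod.fst hw)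
      have h2 := (Submodule.Quotient.eq _).1 (congrArg Prod.snd hw)
      have h3 := sub_mem (neg_mem (Ideal.mul_mem_mul hgI h1)) (Ideal.mul_mem_mul hbI h2)
      convert h3 using 1
      ring
  have hexact : Function.Exact β α.rangeRestrict := by
    rintro ⟨u, v⟩
    obtain ⟨u, rfl⟩ := Submodule.Quotient.mk_surjective _ u
    obtain ⟨v, rfl⟩ := Submodule.Quotient.mk_surjective _ v
    rw [← hker, ← Submodule.Quotient.mk_eq_zero, ← hα]
    exact Subtype.ext_iff
  have hexact2 : Function.Exact (LinearMap.range α).subtype (Submodule.factor hle) := by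
    intro a
    obtain ⟨a, rfl⟩ := Submodule.Quotient.mk_surjective _ a
    refine (Submodule.Quotient.mk_eq_zero I).trans ?_
    constructor
    · intro h
      obtain ⟨u, v, rfl⟩ := Ideal.mem_span_pair.1 h
      refine ⟨⟨_, (Submodule.Quotient.mk u, Submodule.Quotient.mk v), rfl⟩, ?_⟩
      exact (hα u v).trans (by rw [mul_comm g, mul_comm b])
    · rintro ⟨⟨_, ⟨u, v⟩, rfl⟩, h⟩
      obtain ⟨u, rfl⟩ := Submodule.Quotient.mk_surjective _ u
      obtain ⟨v, rfl⟩ := Submodule.Quotient.mk_surjective _ v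
      have h1 := hle ((Submodule.Quotient.eq _).1 ((hα u v).symm.trans h))
      have h2 : g * u + b * v ∈ I := add_mem (Ideal.mul_mem_right _ _ hgI)
        (Ideal.mul_mem_right _ _ hbI)
      exact (Submodule.sub_mem_iff_right I h2).1 h1
  have hfr : Module.Finite K (LinearMap.range α) :=
    Module.Finite.of_surjective (α.rangeRestrict.restrictScalars K) α.surjective_rangeRestrict
  have h1 := finite_and_finrank_of_exact (β.restrictScalars K) (α.rangeRestrict.restrictScalars K)
    hβinj α.surjective_rangeRestrict hexact
  have h2 := finite_and_finrank_of_exact ((LinearMap.range α).subtype.restrictScalars K)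
    ((Submodule.factor hle).restrictScalars K) (Submodule.subtype_injective _)
    (Submodule.factor_surjective hle) hexact2
  refine ⟨h2.1, ?_⟩
  have h3 := h1.2
  rw [Module.finrank_prod] at h3
  have h4 := h2.2
  omega

/-- The colength of `(g, b) 𝔪ᵏ`, for a regular sequence `g, b` in which `g` has order `r` and `b`
has order at least `r`, differs from the colength of `(g, b)` by a number that depends only on
`k` and `r`. -/
theorem colength_mul_pow {g b : O₂} {r : ℕ} (hg : g ∈ 𝔪 ^ r) (hg' : g ∉ 𝔪 ^ (r + 1))
    (hb : b ∈ 𝔪 ^ r) (hgb : ∀ c, g ∣ b * c → g ∣ c)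
    [Module.Finite ℂ (O₂ ⧸ Ideal.span {g, b})] (k : ℕ) :
    Module.Finite ℂ (O₂ ⧸ Ideal.span {g, b} * 𝔪 ^ k) ∧
      Module.finrank ℂ (O₂ ⧸ Ideal.span {g, b} * 𝔪 ^ k) + Module.finrank ℂ (O₂ ⧸ 𝔪 ^ (k - r)) =
        Module.finrank ℂ (O₂ ⧸ Ideal.span {g, b}) + 2 * Module.finrank ℂ (O₂ ⧸ 𝔪 ^ k) := by
  -- Here `J = 𝔪ᵏ` and `L = 𝔪ᵏ⁻ʳ`; for `k ≤ r` the truncated subtraction makes `L` the whole ring,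
  -- as it should be.
  have hdeg : ∀ {c a : O₂}, c ∈ 𝔪 ^ r → a ∈ 𝔪 ^ (k - r) → c * a ∈ 𝔪 ^ k := fun hc ha =>
    Ideal.pow_le_pow_right (by omega : k ≤ r + (k - r)) (by
      rw [pow_add]; exact Ideal.mul_mem_mul hc ha)
  refine colength_span_pair_mul (fun h => hg' (h ▸ zero_mem _))
    (fun a => ⟨fun h => ?_, hdeg hg⟩) (fun a => hdeg hb) hgb
  rw [mul_comm] at h
  exact mem_pow_of_mul_mem hg hg' h

/-! ### Adapted coordinates -/

/-- The polar formula for the vertical direction, when it is not tangent to the curve. -/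
theorem polar_formula_of_yRegular {f : O₂} {n : ℕ} (hn : f ∈ 𝔪 ^ (n + 1))
    (hr : YRegular f (n + 1)) (hsq : Squarefree f) (k : ℕ) :
    Module.Finite ℂ (O₂ ⧸ Ideal.span {dy f, f} * 𝔪 ^ k) ∧
      Module.Finite ℂ (O₂ ⧸ Ideal.span {dy f, dx f} * 𝔪 ^ k) ∧
      Module.finrank ℂ (O₂ ⧸ Ideal.span {dy f, f} * 𝔪 ^ k) =
        Module.finrank ℂ (O₂ ⧸ Ideal.span {dy f, dx f} * 𝔪 ^ k) + n := by
  have hfm : f ∈ 𝔪 := Ideal.pow_le_self n.succ_ne_zero hn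
  have hg : YRegular (dy f) n := hr.dy
  have hgn : dy f ∈ 𝔪 ^ n := dv_mem_pow _ hn
  have hgn' : dy f ∉ 𝔪 ^ (n + 1) := by
    intro h
    obtain ⟨u, hu, h1⟩ := hg
    have h2 := restr_mem_of_mem_pow (0, 1) h
    rw [h1, pow_succ, mul_dvd_mul_iff_left (pow_ne_zero _ T_ne_zero)] at h2
    exact not_isUnit_T (isUnit_of_dvd_unit h2 hu)
  have hcf : ∀ q, Prime q → q ∣ dy f → ¬ q ∣ f := fun q hq hqy =>
    not_dvd_of_squarefree hr hsq hq hqy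
  obtain ⟨hcx, hdim⟩ := colength_polar hfm hg dvd_rfl hcf
  have := finite_of_coprime hg hcf
  have := finite_of_coprime hg hcx
  -- Both pairs share `f_y`, of order exactly `n`, and the other generators have order at least `n`:
  -- the corrections in `h1` and `h2` coincide.
  have h1 := colength_mul_pow hgn hgn' (Ideal.pow_le_pow_right n.le_succ hn)
    (dvd_of_dvd_mul_of_coprime hg hcf) k
  have hxn : dx f ∈ 𝔪 ^ n := dv_mem_pow _ hn
  have h2 := colength_mul_pow (b := dx f) hgn hgn' hxn
    (dvd_of_dvd_mul_of_coprime hg hcx) k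
  refine ⟨h1.1, h2.1, ?_⟩
  have h3 := h1.2
  have h4 := h2.2
  omega

/-! ### Linear changes of coordinates -/

theorem restr_pull (A : ℂ × ℂ →L[ℂ] ℂ × ℂ) (w : ℂ × ℂ) (f : O₂) :
    restr w (pull A f) = restr (A w) f := by
  obtain ⟨f, hf, rfl⟩ := exists_germ₂ f
  rw [pull_germ₂, restr_germ₂, restr_germ₂]
  congr 1
  funext t
  simp

theorem map_pullEquiv_𝔪 (A : (ℂ × ℂ) ≃L[ℂ] ℂ × ℂ) :
    (𝔪).map (pullEquiv A : O₂ →+* O₂) = 𝔪 := by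
  have h : ∀ A : (ℂ × ℂ) ≃L[ℂ] ℂ × ℂ, (𝔪).map (pullEquiv A : O₂ →+* O₂) ≤ 𝔪 := fun A => by
    rw [Ideal.map_le_iff_le_comap]
    exact fun φ hφ => (evalZero_pull _ φ).trans hφ
  refine le_antisymm (h A) fun φ hφ => ?_
  have h1 : (pullEquiv A).symm φ ∈ 𝔪 := (evalZero_pull A.symm.toContinuousLinearMap φ).trans hφ
  have h2 := Ideal.mem_map_of_mem (pullEquiv A : O₂ →+* O₂) h1
  have h3 : (pullEquiv A : O₂ →+* O₂) ((pullEquiv A).symm φ) = φ :=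
    (pullEquiv A).apply_symm_apply φ
  rwa [h3] at h2

/-- By the chain rule the derivatives of the pulled back germ are pulled back directional
derivatives of `f`. Applying this to the inverse change gives equality. -/
theorem map_pullEquiv_jacobian_le (A : (ℂ × ℂ) ≃L[ℂ] ℂ × ℂ) (f : O₂) :
    Ideal.span {dx (pullEquiv A f), dy (pullEquiv A f)} ≤
      (Ideal.span {dx f, dy f}).map (pullEquiv A : O₂ →+* O₂) := by
  have h : ∀ v, dv v (pullEquiv A f) ∈ (Ideal.span {dx f, dy f}).map (pullEquiv A : O₂ →+* O₂) := by
    intro v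
    rw [pullEquiv_apply, dv_pull]
    refine Ideal.mem_map_of_mem (pullEquiv A : O₂ →+* O₂) ?_
    rw [dv_eq]
    exact add_mem (Submodule.smul_of_tower_mem _ _ (Ideal.subset_span (by simp)))
      (Submodule.smul_of_tower_mem _ _ (Ideal.subset_span (by simp)))
  rw [Ideal.span_le]
  rintro z (rfl | rfl)
  exacts [h _, h _]

theorem map_pullEquiv_jacobian (A : (ℂ × ℂ) ≃L[ℂ] ℂ × ℂ) (f : O₂) :
    (Ideal.span {dx f, dy f}).map (pullEquiv A : O₂ →+* O₂) =
      Ideal.span {dx (pullEquiv A f), dy (pullEquiv A f)} := by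
  refine le_antisymm ?_ (map_pullEquiv_jacobian_le A f)
  have h := Ideal.map_mono (f := (pullEquiv A : O₂ →+* O₂))
    (map_pullEquiv_jacobian_le A.symm (pullEquiv A f))
  have h1 : pullEquiv A.symm (pullEquiv A f) = f := (pullEquiv A).symm_apply_apply f
  have h2 : (pullEquiv A : O₂ →+* O₂).comp (pullEquiv A.symm : O₂ →+* O₂) = RingHom.id _ :=
    RingHom.ext fun φ => (pullEquiv A).apply_symm_apply φ
  rwa [h1, Ideal.map_map, h2, Ideal.map_id] at h

theorem map_pullEquiv_milnorIdeal (A : (ℂ × ℂ) ≃L[ℂ] ℂ × ℂ) (f : O₂) (k : ℕ) :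
    (milnorIdeal f k).map (pullEquiv A : O₂ →+* O₂) = milnorIdeal (pullEquiv A f) k := by
  rw [milnorIdeal, Ideal.map_mul, Ideal.map_pow, map_pullEquiv_𝔪, map_pullEquiv_jacobian,
    milnorIdeal]

theorem map_pullEquiv_polarIdeal {A : (ℂ × ℂ) ≃L[ℂ] ℂ × ℂ} {α β : ℂ} (hA : A (0, 1) = (α, β))
    (f : O₂) (k : ℕ) : (polarIdeal f α β k).map (pullEquiv A : O₂ →+* O₂) =
      Ideal.span {dy (pullEquiv A f), pullEquiv A f} * 𝔪 ^ k := by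
  have h1 : (pullEquiv A : O₂ →+* O₂) (polar f α β) = dy (pullEquiv A f) := by
    rw [dy_eq_dv, pullEquiv_apply, dv_pull]
    change pull A _ = pull A _
    rw [ContinuousLinearEquiv.coe_coe, hA, dv_eq, polar]
  rw [polarIdeal, Ideal.map_mul, Ideal.map_pow, map_pullEquiv_𝔪, Ideal.map_span, Set.image_pair, h1]
  rfl

theorem squarefree_pullEquiv (A : (ℂ × ℂ) ≃L[ℂ] ℂ × ℂ) {f : O₂} (h : Squarefree f) :
    Squarefree (pullEquiv A f) := by
  intro x hx
  have h1 := map_dvd (pullEquiv A).symm hx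
  rw [map_mul, AlgEquiv.symm_apply_apply] at h1
  have h2 := (h _ h1).map (pullEquiv A)
  rwa [AlgEquiv.apply_symm_apply] at h2

/-! ### Generic directions -/

theorem eval_smul_of_isHomogeneous {n : ℕ} {p : MvPolynomial (Fin 2) ℂ} (hp : p.IsHomogeneous n)
    (c : ℂ) (v : Fin 2 → ℂ) :
    MvPolynomial.eval (c • v) p = c ^ n * MvPolynomial.eval v p := by
  rw [MvPolynomial.eval_eq', MvPolynomial.eval_eq', Finset.mul_sum]
  refine Finset.sum_congr rfl fun d hd => ?_
  have hdn : d 0 + d 1 = n := by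
    have := hp (MvPolynomial.mem_support_iff.1 hd)
    rw [Finsupp.weight_apply, Finsupp.sum_fintype _ _ (by simp)] at this
    simpa [Fin.sum_univ_two] using this
  simp only [Fin.prod_univ_two, Pi.smul_apply, smul_eq_mul, mul_pow, ← hdn, pow_add]
  ring

/-- The directions in which a form does not vanish. -/
def nonvanishing (p : MvPolynomial (Fin 2) ℂ) : Set Directions :=
  {v | MvPolynomial.eval v.rep p ≠ 0}

theorem mk_mem_nonvanishing {n : ℕ} {p : MvPolynomial (Fin 2) ℂ} (hp : p.IsHomogeneous n)
    (v : Fin 2 → ℂ) (hv : v ≠ 0) :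
    Projectivization.mk ℂ v hv ∈ nonvanishing p ↔ MvPolynomial.eval v p ≠ 0 := by
  obtain ⟨a, ha⟩ := Projectivization.exists_smul_eq_mk_rep ℂ v hv
  rw [nonvanishing, Set.mem_ofPred_eq, ← ha, Units.smul_def, eval_smul_of_isHomogeneous hp]
  exact mul_ne_zero_iff_left (pow_ne_zero n a.ne_zero)

theorem isZariskiOpen_nonvanishing {n : ℕ} {p : MvPolynomial (Fin 2) ℂ} (hp : p.IsHomogeneous n) :
    IsZariskiOpen (nonvanishing p) :=
  ⟨{p}, by rintro _ rfl; exact ⟨n, hp⟩, fun v hv => by simp [mk_mem_nonvanishing hp v hv]⟩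

theorem nonvanishing_nonempty {n : ℕ} {p : MvPolynomial (Fin 2) ℂ} (hp : p.IsHomogeneous (n + 1))
    (h0 : p ≠ 0) : (nonvanishing p).Nonempty := by
  obtain ⟨v, hv⟩ : ∃ v, MvPolynomial.eval v p ≠ 0 := by
    by_contra! h
    exact h0 (MvPolynomial.funext fun v => by rw [h v, map_zero])
  -- Positive degree makes the form vanish at the origin.
  have hv0 : v ≠ 0 := by
    rintro rfl
    have := eval_smul_of_isHomogeneous hp 0 0
    rw [zero_smul, zero_pow n.succ_ne_zero, zero_mul] at this
    exact hv this
  exact ⟨_, (mk_mem_nonvanishing hp v hv0).2 hv⟩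

/-- On a line not tangent to the curve, the leading form contributes a nonzero multiple of `Tⁿ` and
the rest has higher order. -/
theorem exists_restr_eq {n : ℕ} {f : O₂} {p : MvPolynomial (Fin 2) ℂ} (hp : p.IsHomogeneous n)
    (hfp : f - poly p ∈ 𝔪 ^ (n + 1)) {w : ℂ × ℂ} (hw : MvPolynomial.eval ![w.1, w.2] p ≠ 0) :
    ∃ u, IsUnit u ∧ restr w f = T ^ n * u := by
  obtain ⟨c, hc⟩ := restr_mem_of_mem_pow w hfp
  rw [map_sub, restr_poly w hp, Algebra.smul_def] at hc
  refine ⟨algebraMap ℂ O₁ (MvPolynomial.eval ![w.1, w.2] p) + T * c, ?_, by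
    linear_combination hc⟩
  rw [isUnit_iff_evalZeroLine, map_add, map_mul, evalZeroLine_algebraMap,
    (T_dvd_iff T).1 dvd_rfl, zero_mul, add_zero]
  exact hw

end PlaneGerm

end

/-- For the reduced curve `C = {f = 0}`, the polar curves of `df` in all directions of some
nonempty Zariski-open set, which does not depend on `k`, satisfy
`iᵏ(𝒫, C) = μᵏ(C) + ν(f) - 1` for every `k`, both dimensions being finite. -/
theorem mainTheorem4 (f : PlaneGerm.O₂) (hf : PlaneGerm.IsReducedCurve f) :
    ∃ U : Set PlaneGerm.Directions, PlaneGerm.IsZariskiOpen U ∧ U.Nonempty ∧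
      ∀ (α β : ℂ) (h : ![α, β] ≠ 0), Projectivization.mk ℂ ![α, β] h ∈ U → ∀ k : ℕ,
        Module.Finite ℂ (PlaneGerm.O₂ ⧸ PlaneGerm.polarIdeal f α β k) ∧
        Module.Finite ℂ (PlaneGerm.O₂ ⧸ PlaneGerm.milnorIdeal f k) ∧
        (PlaneGerm.polarNumber f α β k : ℤ) =
          (PlaneGerm.milnorNumber f k : ℤ) + (PlaneGerm.algMultiplicity f : ℤ) - 1 := by
  open PlaneGerm in
  obtain ⟨hfm, hsq⟩ := hf
  obtain ⟨n, hn, hn'⟩ := exists_order hsq.ne_zero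
  -- Since `f` vanishes at the origin its order is positive; written `n + 1`, it makes `ν(f) - 1 =
  -- n`.
  rcases n with _ | n
  · exact absurd (by simpa using hfm) hn'
  obtain ⟨p, hp, hfp⟩ := exists_leadingForm hn
  have hp0 : p ≠ 0 := by
    rintro rfl
    exact hn' (by simpa using hfp)
  -- `U` is the complement of the tangent cone, so it does not depend on `k`.
  refine ⟨nonvanishing p, isZariskiOpen_nonvanishing hp, nonvanishing_nonempty hp hp0, ?_⟩
  intro α β h hU k
  rw [mk_mem_nonvanishing hp] at hU
  have hαβ : ((α, β) : ℂ × ℂ) ≠ 0 := by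
    intro h0
    rw [Prod.mk_eq_zero] at h0
    exact h (by rw [h0.1, h0.2]; ext i; fin_cases i <;> rfl)
  -- A linear automorphism carrying the vertical direction to `(α, β)` turns `α f_x + β f_y` into
  -- the `y`-derivative of the pulled back germ.
  obtain ⟨A, hA⟩ := SeparatingDual.exists_continuousLinearEquiv_apply_eq (R := ℂ)
    (x := ((0, 1) : ℂ × ℂ)) (by simp) hαβ
  have hr : YRegular (pullEquiv A f) (n + 1) := by
    obtain ⟨u, hu, h1⟩ := exists_restr_eq hp hfp (w := (α, β)) hU
    refine ⟨u, hu, ?_⟩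
    rw [← h1, pullEquiv_apply, restr_pull, ContinuousLinearEquiv.coe_coe, hA]
  have hnA : pullEquiv A f ∈ 𝔪 ^ (n + 1) := by
    have h1 := Ideal.mem_map_of_mem (pullEquiv A : O₂ →+* O₂) hn
    rwa [Ideal.map_pow, map_pullEquiv_𝔪] at h1
  obtain ⟨h1, h2, h3⟩ := polar_formula_of_yRegular hnA hr (squarefree_pullEquiv A hsq) k
  rw [Set.pair_comm (dy _) (dx _)] at h2 h3
  let e1 := Ideal.quotientEquivAlg (polarIdeal f α β k) _ (pullEquiv A)
    (map_pullEquiv_polarIdeal hA f k).symm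
  let e2 := Ideal.quotientEquivAlg (milnorIdeal f k) _ (pullEquiv A)
    (map_pullEquiv_milnorIdeal A f k).symm
  refine ⟨Module.Finite.equiv e1.symm.toLinearEquiv,
    @Module.Finite.equiv _ _ _ _ _ _ _ _ h2 e2.symm.toLinearEquiv, ?_⟩
  rw [polarNumber, milnorNumber, algMultiplicity_eq hn hn', e1.toLinearEquiv.finrank_eq,
    e2.toLinearEquiv.finrank_eq, h3]
  change _ = (Module.finrank ℂ (O₂ ⧸ milnorIdeal (pullEquiv A f) k) : ℤ) + _ - 1
  rw [milnorIdeal]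
  push_cast
  ring
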